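/- Let $Q$ be a finite-dimensional smooth manifold (Hausdorff, second countable, without boundary) with tangent projection $\tau_Q:TQ\to Q$. Let $\Gamma$ be a smooth, complete second order vector field (SODE) on $TQ$, that is, $T\tau_Q(\Gamma(v))=v$ for all $v\in TQ$, with flow $\Phi^\Gamma_t$. For $h>0$ put $$\exp^\Gamma_h:TQ\to Q\times Q,\qquad \exp^\Gamma_h(v)=\big(\tau_Q(v),\,\tau_Q(\Phi^\Gamma_h(v))\big).$$ If $U\subseteq Q$ and $\mathcal U\subseteq TQ$ are open and $\exp^\Gamma_h$ restricts to a diffeomorphism $\mathcal U\to U\times U$ with inverse $R^{e^-}_h:U\times U\to\mathcal U$, define the discrete second order difference equation $$\Gamma_d(q_{k-1},q_k)=\big(q_{k-1},\,q_k,\,q_k,\ (\tau_Q\circ\Phi^\Gamma_{2h}\circ R^{e^-}_h)(q_{k-1},q_k)\big),\qquad (q_{k-1},q_k)\in U\times U .$$ The SODE $\Gamma$ is called variational if there is a smooth regular Lagrangian $L:TQ\to\mathbb R$ (i.e. $\partial^2L/\partial\dot q^i\partial\dot q^j$ is nondegenerate everywhere) such that the second order differential equation $\ddot q=\Gamma(q,\dot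 q)$ and the Euler-Lagrange equations $\frac{d}{dt}\frac{\partial L}{\partial\dot q^i}-\frac{\partial L}{\partial q^i}=0$ have the same $C^2$ solutions. The difference equation $\Gamma_d$ on $U\times U$ is called variational if there is a smooth regular discrete Lagrangian $L_d:U\times U\to\mathbb R$ (i.e. $D_{12}L_d$ is nondegenerate everywhere) such that for all $q_{k-1},q_k,q_{k+1}\in U$ $$\Gamma_d(q_{k-1},q_k)=(q_{k-1},q_k,q_k,q_{k+1})\iff D_1L_d(q_k,q_{k+1})+D_2L_d(q_{k-1},q_k)=0 .$$ Theorem. Suppose $\Gamma$ is variational and let $q_0\in Q$. Then there are a neighbourhood $\mathcal W$ of the zero vector $0_{q_0}$ in $TQ$ and an $h_0>0$ such that for every $h\in(0,h_0)$: 1. there are open sets $U\ni q_0$ in $Q$ and $\mathcal U\subseteq\mathcal W$ such that $\exp^\Gamma_h$ restricts to a diffeomorphism $\mathcal U\to U\times U$ and $\Gamma_d(q_0,q_0)\in U\times U\times U\times U$; 2. for all open sets $U\subseteq Q$ and $\mathcal U\subseteq\mathcal W$ such that $\exp^\Gamma_h$ restricts to a diffeomorphism $\mathcal U\to U\times U$,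 the discrete second order difference equation $\Gamma_d$ on $U\times U$ is variational. -/

import Mathlib

open Set Topology
open scoped Manifold ContDiff

noncomputable section

section Continuous

variable {E : Type*} [NormedAddCommGroup E] [NormedSpace ℝ E]
  {Q : Type*} [TopologicalSpace Q] [ChartedSpace E Q] [IsManifold 𝓘(ℝ, E) ∞ Q]

/-- A vector field `Γ` on `TQ` is a (smooth) SODE if `T τ_Q (Γ v) = v` for all `v ∈ TQ`. -/
structure IsSODE (Γ : (v : TangentBundle 𝓘(ℝ, E) Q) → TangentSpace 𝓘(ℝ, E).tangent v) :
    Prop where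
  smooth : ContMDiff 𝓘(ℝ, E).tangent 𝓘(ℝ, E).tangent.tangent ∞
    (fun v => (⟨v, Γ v⟩ :
      TangentBundle 𝓘(ℝ, E).tangent (TangentBundle 𝓘(ℝ, E) Q)))
  second_order : ∀ v : TangentBundle 𝓘(ℝ, E) Q,
    mfderiv 𝓘(ℝ, E).tangent 𝓘(ℝ, E)
      (fun w : TangentBundle 𝓘(ℝ, E) Q => w.proj) v (Γ v) = v.snd

/-- `Γ` is complete: through every point of `TQ` there is an integral curve defined on `ℝ`. -/
def IsCompleteField
    (Γ : (v : TangentBundle 𝓘(ℝ, E) Q) → TangentSpace 𝓘(ℝ, E).tangent v) : Prop :=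
  ∀ v : TangentBundle 𝓘(ℝ, E) Q,
    ∃ γ : ℝ → TangentBundle 𝓘(ℝ, E) Q, γ 0 = v ∧ IsMIntegralCurve γ Γ

/-- The flow `Φ_t(v)` of a complete vector field: the value at time `t` of the integral curve
starting at `v` (which is unique when `Γ` is smooth and `Q` is Hausdorff). -/
def sodeFlow {Γ : (v : TangentBundle 𝓘(ℝ, E) Q) → TangentSpace 𝓘(ℝ, E).tangent v}
    (hc : IsCompleteField Γ) (t : ℝ) (v : TangentBundle 𝓘(ℝ, E) Q) :
    TangentBundle 𝓘(ℝ, E) Q :=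
  (hc v).choose t

/-- The velocity curve `t ↦ (c t, ċ t)` in `TQ` of a curve `c` in `Q`. -/
def velocityLift (c : ℝ → Q) (t : ℝ) : TangentBundle 𝓘(ℝ, E) Q :=
  ⟨c t, mfderiv 𝓘(ℝ, ℝ) 𝓘(ℝ, E) c t (1 : ℝ)⟩

/-- `c` solves the second order equation of `Γ` on `J`: its velocity curve is an integral curve
of `Γ`, in coordinates `q'' = Γ(q, q')`. -/
def SolvesSODE (Γ : (v : TangentBundle 𝓘(ℝ, E) Q) → TangentSpace 𝓘(ℝ, E).tangent v)
    (c : ℝ → Q) (J : Set ℝ) : Prop :=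
  IsMIntegralCurveOn (velocityLift (E := E) c) Γ J

/-- A Lagrangian written in the natural coordinates `(x, v)` of `TQ` induced by the chart of `Q`
at `q₁`. -/
def localLagrangian (L : TangentBundle 𝓘(ℝ, E) Q → ℝ) (q₁ : Q) (x v : E) : ℝ :=
  L ((extChartAt 𝓘(ℝ, E).tangent (⟨q₁, 0⟩ : TangentBundle 𝓘(ℝ, E) Q)).symm (x, v))

/-- `∂L/∂q` in the chart at `q₁`. -/
def dLdq (L : TangentBundle 𝓘(ℝ, E) Q → ℝ) (q₁ : Q) (x v : E) : E →L[ℝ] ℝ :=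
  fderiv ℝ (fun y => localLagrangian L q₁ y v) x

/-- `∂L/∂q̇` in the chart at `q₁`. -/
def dLdv (L : TangentBundle 𝓘(ℝ, E) Q → ℝ) (q₁ : Q) (x v : E) : E →L[ℝ] ℝ :=
  fderiv ℝ (fun u => localLagrangian L q₁ x u) v

/-- A smooth Lagrangian on `TQ` is regular if its Hessian `∂²L/∂q̇∂q̇` is nondegenerate at every
point (in every natural chart of `TQ`). -/
structure IsRegularLagrangian (L : TangentBundle 𝓘(ℝ, E) Q → ℝ) : Prop where
  smooth : ContMDiff 𝓘(ℝ, E).tangent 𝓘(ℝ, ℝ) ∞ L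
  nondegenerate : ∀ q₁ : Q, ∀ x ∈ (extChartAt 𝓘(ℝ, E) q₁).target, ∀ v e : E,
    (∀ f : E, fderiv ℝ (fun u => dLdv L q₁ x u) v e f = 0) → e = 0

/-- `c` solves the Euler-Lagrange equations `d/dt (∂L/∂q̇) = ∂L/∂q` of `L` on `J`: at each time of
`J` they hold in every chart around the point reached. -/
def SolvesEulerLagrange (L : TangentBundle 𝓘(ℝ, E) Q → ℝ) (c : ℝ → Q) (J : Set ℝ) : Prop :=
  ∀ t ∈ J, ∀ q₁ : Q, c t ∈ (chartAt E q₁).source →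
    HasDerivAt
      (fun s => dLdv L q₁ (extChartAt 𝓘(ℝ, E) q₁ (c s))
        (deriv (fun r => extChartAt 𝓘(ℝ, E) q₁ (c r)) s))
      (dLdq L q₁ (extChartAt 𝓘(ℝ, E) q₁ (c t))
        (deriv (fun r => extChartAt 𝓘(ℝ, E) q₁ (c r)) t)) t

/-- A SODE is variational if for some regular Lagrangian `L : TQ → ℝ` its second order equation
and the Euler-Lagrange equations have the same `C²` solutions on every open interval `J`. -/
def IsVariationalSODE
    (Γ : (v : TangentBundle 𝓘(ℝ, E) Q) → TangentSpace 𝓘(ℝ, E).tangent v) : Prop :=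
  ∃ L : TangentBundle 𝓘(ℝ, E) Q → ℝ, IsRegularLagrangian L ∧
    ∀ (J : Set ℝ), IsOpen J → J.OrdConnected →
      ∀ c : ℝ → Q, ContMDiffOn 𝓘(ℝ, ℝ) 𝓘(ℝ, E) 2 c J →
        (SolvesSODE Γ c J ↔ SolvesEulerLagrange L c J)

/-- The exponential map `v ↦ (τ_Q v, τ_Q (Φ_h v))` of a complete SODE. -/
def sodeExp {Γ : (v : TangentBundle 𝓘(ℝ, E) Q) → TangentSpace 𝓘(ℝ, E).tangent v}
    (hc : IsCompleteField Γ) (h : ℝ) (v : TangentBundle 𝓘(ℝ, E) Q) : Q × Q :=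
  (v.proj, (sodeFlow hc h v).proj)

/-- The exponential map at time `h` restricts to a diffeomorphism from the open set `D ⊆ TQ` onto
`U × U`, with `U ⊆ Q` open, and `R` is its inverse (values of `R` off `U × U` are irrelevant). -/
structure IsExpInverse {Γ : (v : TangentBundle 𝓘(ℝ, E) Q) → TangentSpace 𝓘(ℝ, E).tangent v}
    (hc : IsCompleteField Γ) (h : ℝ) (U : Set Q) (D : Set (TangentBundle 𝓘(ℝ, E) Q))
    (R : Q × Q → TangentBundle 𝓘(ℝ, E) Q) : Prop where
  isOpen_base : IsOpen U
  isOpen_domain : IsOpen D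
  mapsTo_exp : MapsTo (sodeExp hc h) D (U ×ˢ U)
  mapsTo_inv : MapsTo R (U ×ˢ U) D
  invOn : InvOn R (sodeExp hc h) D (U ×ˢ U)
  smooth_exp : ContMDiffOn 𝓘(ℝ, E).tangent (𝓘(ℝ, E).prod 𝓘(ℝ, E)) ∞ (sodeExp hc h) D
  smooth_inv : ContMDiffOn (𝓘(ℝ, E).prod 𝓘(ℝ, E)) 𝓘(ℝ, E).tangent ∞ R (U ×ˢ U)

/-- The discrete second order difference equation
`(q_{k-1}, q_k) ↦ (q_{k-1}, q_k, q_k, τ_Q (Φ_{2h} (R (q_{k-1}, q_k))))`. -/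
def discreteOfSODE {Γ : (v : TangentBundle 𝓘(ℝ, E) Q) → TangentSpace 𝓘(ℝ, E).tangent v}
    (hc : IsCompleteField Γ) (h : ℝ) (R : Q × Q → TangentBundle 𝓘(ℝ, E) Q) (p : Q × Q) :
    (Q × Q) × (Q × Q) :=
  (p, (p.2, (sodeFlow hc (2 * h) (R p)).proj))

end Continuous

section Discrete

variable {E : Type*} [NormedAddCommGroup E] [NormedSpace ℝ E]
  {Q : Type*} [TopologicalSpace Q] [ChartedSpace E Q]

/-- `D₁L_d(a, b) ∈ T*_a Q`. -/
def slotDerivOne (Ld : Q × Q → ℝ) (a b : Q) : TangentSpace 𝓘(ℝ, E) a →L[ℝ] ℝ :=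
  mfderiv 𝓘(ℝ, E) 𝓘(ℝ, ℝ) (fun x => Ld (x, b)) a

/-- `D₂L_d(a, b) ∈ T*_b Q`. -/
def slotDerivTwo (Ld : Q × Q → ℝ) (a b : Q) : TangentSpace 𝓘(ℝ, E) b →L[ℝ] ℝ :=
  mfderiv 𝓘(ℝ, E) 𝓘(ℝ, ℝ) (fun y => Ld (a, y)) b

/-- The mixed second derivative `D₁₂L_d(a, b)(w, ·)`: the derivative at `b` of
`y ↦ D₁L_d(a, y)(w)`. -/
def mixedDeriv (Ld : Q × Q → ℝ) (a b : Q) (w : TangentSpace 𝓘(ℝ, E) a) :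
    TangentSpace 𝓘(ℝ, E) b →L[ℝ] ℝ :=
  mfderiv 𝓘(ℝ, E) 𝓘(ℝ, ℝ) (fun y => slotDerivOne (E := E) Ld a y w) b

/-- A discrete Lagrangian, smooth on `V ⊆ Q × Q`, is regular if `D₁₂L_d` is nondegenerate at every
point of `V`. -/
structure IsRegularDiscreteLagrangian (E : Type*) [NormedAddCommGroup E] [NormedSpace ℝ E]
    {Q : Type*} [TopologicalSpace Q] [ChartedSpace E Q]
    (V : Set (Q × Q)) (Ld : Q × Q → ℝ) : Prop where
  smooth : ContMDiffOn (𝓘(ℝ, E).prod 𝓘(ℝ, E)) 𝓘(ℝ, ℝ) ∞ Ld V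
  nondegenerate : ∀ a b : Q, (a, b) ∈ V → ∀ w : TangentSpace 𝓘(ℝ, E) a,
    (∀ u : TangentSpace 𝓘(ℝ, E) b, mixedDeriv Ld a b w u = 0) → w = 0

/-- The difference equation `Γd` on `V ⊆ Q × Q` is variational if some regular discrete Lagrangian
on `V` is such that, for consecutive pairs `(a, b)`, `(b, c)` of `V`, the equation
`Γd (a, b) = (a, b, b, c)` is equivalent to `D₁L_d(b, c) + D₂L_d(a, b) = 0`. -/
def IsVariationalSOdE (E : Type*) [NormedAddCommGroup E] [NormedSpace ℝ E]
    {Q : Type*} [TopologicalSpace Q] [ChartedSpace E Q]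
    (V : Set (Q × Q)) (Γd : Q × Q → (Q × Q) × (Q × Q)) : Prop :=
  ∃ Ld : Q × Q → ℝ, IsRegularDiscreteLagrangian E V Ld ∧
    ∀ a b c : Q, (a, b) ∈ V → (b, c) ∈ V →
      (Γd (a, b) = ((a, b), (b, c)) ↔
        slotDerivOne (E := E) Ld b c + slotDerivTwo (E := E) Ld a b = 0)

end Discrete

end

/-!
The discrete Lagrangian that makes `Γ_d` variational is the exact one, the action
`L_d(a, b) = ∫₀ʰ L(q, q̇) dt` along the trajectory of `Γ` that joins `a` to `b` in time `h`. Since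
`0_{q₀}` has small neighbourhoods that the flow does not leave for short times, everything
takes place in the natural chart of `TQ` at `q₀`, where `Γ` is an equation `q̈ = G(q, q̇)`.

*Smooth flow.* The flow of a smooth field is smooth in time and initial condition jointly
(`exists_contDiffOn_localFlow`): the trajectory from `y` rescaled to `[0, 1]` is the zero in
`C([0, 1], F)` of `u ↦ u - ε ∫₀ X(y + u)`, which depends smoothly on `u`, because superposition
operators of smooth maps are smooth, and on `(ε, y)`; at `ε = 0` its derivative in `u` is the
identity, so the inverse function theorem applies. Adding the equation `ṡ = L` makes the
action `S(t, y)` a component of a flow, hence smooth.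

*First variation.* As solutions of `Γ` satisfy the Euler-Lagrange equations, the differential of
the action consists of boundary terms: `dS(t, ·) = ∂L/∂q̇|ₜ dq(t) - ∂L/∂q̇|₀ dq(0)`
(`IsLagrangianFlow.fderiv_action`). So `D₁L_d = -∂L/∂q̇` at the initial and `D₂L_d = ∂L/∂q̇` at the
final velocity of the joining arc. The discrete Euler-Lagrange equations
express that the momenta of consecutive arcs match. Near the zero vector the Legendre transformation
is injective on fibres, and then the arcs form one trajectory
(`IsSmallLagrangianFlow.discrete_eulerLagrange_iff`). Up to sign, `D₁₂L_d` is the velocity Hessian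
of `L` composed with the derivative of the initial velocity in the end point, both of which are
nondegenerate (`IsSmallLagrangianFlow.discreteLagrangian_nondegenerate`).

*Uniformity in `h`.* The deviation `q(h) - q(0) - h q̇(0)` is Lipschitz in the initial condition,
with constant `h / 2` on a ball that does not depend on `h` (`IsLagrangianFlow.exists_small`). So
`(q, q̇) ↦ (q, (q(h) - q) / h)` is a perturbation of the identity with constant `1 / 2`: it is
injective, has an invertible derivative, and covers a ball of fixed radius. Hence `exp_h` is a
diffeomorphism onto `U × U` for a ball `U` of radius proportional to `h`
(`IsSmallLagrangianFlow.exists_localExp_eq`). The trajectory that returns to `q₀` at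
time `h` is at distance `o(h)` from `q₀` at time `2h`, so it is still in `U`
(`IsSmallLagrangianFlow.flow_two_mul_mem_ball`).
-/

/-! ### Smoothness of superposition operators and local inverses -/

section Superposition

universe u

variable {K : Type*} [TopologicalSpace K] [CompactSpace K]

/-- Pointwise evaluation `(A, h) ↦ (s ↦ A s (h s))` of a continuous family of operators on a
continuous function. -/
noncomputable def ContinuousMap.pointwiseApply (K F G : Type*) [TopologicalSpace K]
    [CompactSpace K] [NormedAddCommGroup F] [NormedSpace ℝ F] [NormedAddCommGroup G]
    [NormedSpace ℝ G] : C(K, F →L[ℝ] G) →L[ℝ] C(K, F) →L[ℝ] C(K, G) :=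
  LinearMap.mkContinuous₂
    (LinearMap.mk₂ ℝ (fun (A : C(K, F →L[ℝ] G)) (h : C(K, F)) =>
        (⟨fun s => A s (h s), by fun_prop⟩ : C(K, G)))
      (fun _ _ _ => by ext; simp) (fun _ _ _ => by ext; simp)
      (fun _ _ _ => by ext; simp) (fun _ _ _ => by ext; simp)) 1
    (fun A h => by
      rw [ContinuousMap.norm_le _ (by positivity)]
      intro s
      simp only [LinearMap.mk₂_apply, ContinuousMap.coe_mk, one_mul]
      exact (A s).le_of_opNorm_le_of_le (A.norm_coe_le_norm s) (h.norm_coe_le_norm s))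

@[simp]
lemma ContinuousMap.pointwiseApply_apply {F G : Type*} [NormedAddCommGroup F] [NormedSpace ℝ F]
    [NormedAddCommGroup G] [NormedSpace ℝ G] (A : C(K, F →L[ℝ] G)) (h : C(K, F)) (s : K) :
    ContinuousMap.pointwiseApply K F G A h s = A s (h s) := rfl

/-- The superposition operator `u ↦ X ∘ u` on continuous functions is differentiable when `X` is
`C¹`, with derivative `h ↦ (s ↦ X'(u s) (h s))`. -/
lemma ContinuousMap.hasFDerivAt_comp_left {F G : Type*} [NormedAddCommGroup F] [NormedSpace ℝ F]
    [NormedAddCommGroup G] [NormedSpace ℝ G] (X : C(F, G)) (X' : C(F, F →L[ℝ] G))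
    (hX : ∀ x, HasFDerivAt X (X' x) x) (u : C(K, F)) :
    HasFDerivAt (fun w : C(K, F) => X.comp w)
      (ContinuousMap.pointwiseApply K F G (X'.comp u)) u := by
  rw [hasFDerivAt_iff_isLittleO_nhds_zero, Asymptotics.isLittleO_iff]
  intro ε hε
  -- continuity of `X'` is uniform along the compact image of `u`
  have hunif := (isCompact_range u.continuous).uniformContinuousAt_of_continuousAt X'
    (fun a _ => X'.continuous.continuousAt) (Metric.dist_mem_uniformity hε)
  obtain ⟨δ, hδ, hδ'⟩ := Metric.mem_uniformity_dist.1 hunif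
  filter_upwards [Metric.ball_mem_nhds (0 : C(K, F)) hδ] with h hh
  rw [ContinuousMap.norm_le _ (by positivity)]
  intro s
  have hs : ‖h s‖ ≤ ‖h‖ := h.norm_coe_le_norm s
  have hball : ∀ z ∈ Metric.ball (u s) δ, ‖X' z - X' (u s)‖ ≤ ε := by
    intro z hz
    have := hδ' (a := u s) (b := z) (by rw [dist_comm]; exact hz) (mem_range_self s)
    rw [← dist_eq_norm, dist_comm]
    exact le_of_lt this
  have key := (convex_ball (u s) δ).norm_image_sub_le_of_norm_hasFDerivWithin_le'
    (f := X) (f' := X') (φ := X' (u s)) (C := ε)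
    (fun z _ => (hX z).hasFDerivWithinAt) hball (Metric.mem_ball_self hδ)
    (y := u s + h s) (by
      rw [Metric.mem_ball, dist_eq_norm, add_sub_cancel_left]
      exact lt_of_le_of_lt hs (by simpa using hh))
  simp only [add_sub_cancel_left] at key
  calc _ = ‖X (u s + h s) - X (u s) - X' (u s) (h s)‖ := by simp
    _ ≤ ε * ‖h s‖ := key
    _ ≤ ε * ‖h‖ := by gcongr

/-- The derivative of a superposition operator is the superposition operator of the derivative
followed by a continuous linear map, so smoothness of finite order follows by induction. -/
lemma ContinuousMap.contDiff_comp_left_nat {F : Type u} [NormedAddCommGroup F] [NormedSpace ℝ F]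
    (n : ℕ) : ∀ {G : Type u} [NormedAddCommGroup G] [NormedSpace ℝ G] (X : C(F, G)),
    ContDiff ℝ n X → ContDiff ℝ n (fun w : C(K, F) => X.comp w) := by
  induction n with
  | zero =>
    intro G _ _ X _
    exact contDiff_zero.2 (ContinuousMap.continuous_postcomp X)
  | succ n ih =>
    intro G _ _ X hX
    have h1 := contDiff_succ_iff_fderiv.1 (show ContDiff ℝ ((n : WithTop ℕ∞) + 1) X from hX)
    have hd : Differentiable ℝ X := h1.1
    have hc : ContDiff ℝ n (fderiv ℝ X) := h1.2.2
    let X' : C(F, F →L[ℝ] G) := ⟨fderiv ℝ X, hc.continuous⟩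
    refine contDiff_succ_iff_hasFDerivAt.2
      ⟨fun u => ContinuousMap.pointwiseApply K F G (X'.comp u), ?_, fun u => ?_⟩
    · exact (ContinuousMap.pointwiseApply K F G).contDiff.comp (ih X' hc)
    · exact ContinuousMap.hasFDerivAt_comp_left X X' (fun x => (hd x).hasFDerivAt) u

/-- The superposition operator of a smooth map is smooth on the Banach space `C(K, F)`. -/
lemma ContinuousMap.contDiff_comp_left {F G : Type u} [NormedAddCommGroup F] [NormedSpace ℝ F]
    [NormedAddCommGroup G] [NormedSpace ℝ G] (X : C(F, G)) (hX : ContDiff ℝ ∞ X) :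
    ContDiff ℝ ∞ (fun w : C(K, F) => X.comp w) :=
  contDiff_infty.2 fun n => ContinuousMap.contDiff_comp_left_nat n X (hX.of_le (mod_cast le_top))

end Superposition

section Primitive

/-- The primitive `w ↦ (s ↦ ∫₀ˢ w)` on `C([0, 1], F)`; the integrand is extended by constants. -/
noncomputable def unitPrimitive (F : Type*) [NormedAddCommGroup F] [NormedSpace ℝ F] :
    C(unitInterval, F) →L[ℝ] C(unitInterval, F) :=
  LinearMap.mkContinuous
    { toFun := fun w => ⟨fun s => ∫ τ in (0 : ℝ)..s, w (projIcc 0 1 zero_le_one τ), by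
        have h : Continuous fun τ : ℝ => w (projIcc 0 1 zero_le_one τ) := by fun_prop
        exact (intervalIntegral.continuous_primitive (fun a b => h.intervalIntegrable a b) 0).comp
          continuous_subtype_val⟩
      map_add' := fun w w' => by
        ext s
        have h : ∀ w : C(unitInterval, F), IntervalIntegrable
            (fun τ : ℝ => w (projIcc 0 1 zero_le_one τ)) MeasureTheory.volume 0 s := fun w =>
          Continuous.intervalIntegrable (by fun_prop) _ _
        simpa using intervalIntegral.integral_add (h w) (h w')
      map_smul' := fun c w => by
        ext s
        simp }
    1 (fun w => by
      rw [ContinuousMap.norm_le _ (by positivity)]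
      intro s
      have := intervalIntegral.norm_integral_le_of_norm_le_const (a := 0) (b := (s : ℝ))
        (f := fun τ : ℝ => w (projIcc 0 1 zero_le_one τ)) (C := ‖w‖)
        (fun τ _ => w.norm_coe_le_norm _)
      have hs : |(s : ℝ) - 0| ≤ 1 := by
        rw [sub_zero, abs_of_nonneg s.2.1]; exact s.2.2
      calc _ ≤ ‖w‖ * |(s : ℝ) - 0| := this
        _ ≤ ‖w‖ * 1 := by gcongr
        _ = 1 * ‖w‖ := mul_comm _ _)

end Primitive

/-- If a smooth local homeomorphism has an invertible derivative at one point, its inverse is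
smooth near the image of that point. -/
lemma OpenPartialHomeomorph.eventually_contDiffAt_symm {A B : Type*} [NormedAddCommGroup A]
    [NormedSpace ℝ A] [CompleteSpace A] [NormedAddCommGroup B] [NormedSpace ℝ B]
    (e : OpenPartialHomeomorph A B) {a : A} (ha : a ∈ e.source)
    (he : ∀ x ∈ e.source, ContDiffAt ℝ ∞ e x) (e' : A ≃L[ℝ] B)
    (h' : HasFDerivAt e (e' : A →L[ℝ] B) a) :
    ∀ᶠ y in 𝓝 (e a), ContDiffAt ℝ ∞ e.symm y := by
  have h1 : ∀ᶠ x in 𝓝 a, fderiv ℝ e x ∈ range ((↑) : (A ≃L[ℝ] B) → A →L[ℝ] B) := by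
    have hcont : ContinuousAt (fderiv ℝ e) a :=
      ((he a ha).fderiv_right (m := 0) (by simp)).continuousAt
    refine hcont ?_
    rw [h'.fderiv]
    exact ContinuousLinearEquiv.nhds e'
  have h2 : Filter.Tendsto e.symm (𝓝 (e a)) (𝓝 a) := by
    have := e.continuousAt_symm (e.map_source ha)
    rwa [ContinuousAt, e.left_inv ha] at this
  filter_upwards [h2.eventually h1, e.open_target.mem_nhds (e.map_source ha)] with y hy hyt
  obtain ⟨f', hf'⟩ := hy
  have hs := he _ (e.map_target hyt)
  refine e.contDiffAt_symm hyt (f₀' := f') ?_ hs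
  rw [hf']
  exact (hs.differentiableAt (by simp)).hasFDerivAt

/-! ### Smooth local flows -/

section Flow

variable {F : Type*} [NormedAddCommGroup F] [NormedSpace ℝ F]

/-- The equation solved by the rescaled trajectories: the second component vanishes iff
`u s = ε ∫₀ˢ X (y + u)`, so that `s ↦ y + u s` solves `z' = ε X(z)`, `z(0) = y` on `[0, 1]`. The
parameters `(ε, y)` are kept as the first component. -/
noncomputable def trajectoryMap (X : C(F, F)) (p : (ℝ × F) × C(unitInterval, F)) :
    (ℝ × F) × C(unitInterval, F) :=
  (p.1, p.2 - p.1.1 • unitPrimitive F (X.comp (ContinuousMap.const _ p.1.2 + p.2)))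

/-- The embedding of `F` into `C([0, 1], F)` as the constant functions. -/
noncomputable def constCLM (F : Type*) [NormedAddCommGroup F] [NormedSpace ℝ F] :
    F →L[ℝ] C(unitInterval, F) :=
  LinearMap.mkContinuous
    { toFun := fun y => ContinuousMap.const _ y
      map_add' := fun _ _ => rfl
      map_smul' := fun _ _ => rfl } 1 (fun y => by
        rw [one_mul]
        exact (ContinuousMap.norm_le _ (norm_nonneg _)).2 fun _ => le_rfl)

lemma contDiff_unitPrimitive_comp (X : C(F, F)) (hX : ContDiff ℝ ∞ X) :
    ContDiff ℝ ∞ fun p : (ℝ × F) × C(unitInterval, F) =>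
      unitPrimitive F (X.comp (ContinuousMap.const _ p.1.2 + p.2)) := by
  have h1 : ContDiff ℝ ∞ fun p : (ℝ × F) × C(unitInterval, F) =>
      ContinuousMap.const unitInterval p.1.2 + p.2 :=
    ((constCLM F).contDiff.comp (contDiff_snd.comp contDiff_fst)).add contDiff_snd
  exact (unitPrimitive F).contDiff.comp ((ContinuousMap.contDiff_comp_left X hX).comp h1)

lemma contDiff_trajectoryMap (X : C(F, F)) (hX : ContDiff ℝ ∞ X) :
    ContDiff ℝ ∞ (trajectoryMap X) :=
  contDiff_fst.prodMk (contDiff_snd.sub ((contDiff_fst.comp contDiff_fst).smul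
    (contDiff_unitPrimitive_comp X hX)))

/-- At `ε = 0` and `u = 0` the derivative of `trajectoryMap` is a shear, hence invertible. -/
lemma hasFDerivAt_trajectoryMap (X : C(F, F)) (hX : ContDiff ℝ ∞ X) (y₀ : F) :
    ∃ e' : ((ℝ × F) × C(unitInterval, F)) ≃L[ℝ] ((ℝ × F) × C(unitInterval, F)),
      HasFDerivAt (trajectoryMap X) (e' : _ →L[ℝ] _) ((0, y₀), 0) := by
  let N : (ℝ × F) × C(unitInterval, F) → C(unitInterval, F) := fun p =>
    unitPrimitive F (X.comp (ContinuousMap.const _ p.1.2 + p.2))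
  have hN : ContDiff ℝ ∞ N := contDiff_unitPrimitive_comp X hX
  set c := N ((0, y₀), 0) with hc
  have hN' := (hN.differentiable (by simp) ((0, y₀), 0)).hasFDerivAt
  have h2 : HasFDerivAt (fun p : (ℝ × F) × C(unitInterval, F) => p.1.1)
      ((ContinuousLinearMap.fst ℝ ℝ F).comp
        (ContinuousLinearMap.fst ℝ (ℝ × F) C(unitInterval, F))) ((0, y₀), 0) :=
    ((ContinuousLinearMap.fst ℝ ℝ F).comp
        (ContinuousLinearMap.fst ℝ (ℝ × F) C(unitInterval, F))).hasFDerivAt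
  have h3 := (hasFDerivAt_fst (𝕜 := ℝ) (E := ℝ × F) (F := C(unitInterval, F))
    (p := ((0, y₀), 0))).prodMk ((hasFDerivAt_snd (𝕜 := ℝ) (E := ℝ × F)
    (F := C(unitInterval, F)) (p := ((0, y₀), 0))).sub (h2.smul hN'))
  refine ⟨ContinuousLinearEquiv.equivOfInverse
    ((ContinuousLinearMap.fst ℝ (ℝ × F) C(unitInterval, F)).prod
      (ContinuousLinearMap.snd ℝ (ℝ × F) C(unitInterval, F) -
        ((ContinuousLinearMap.fst ℝ ℝ F).comp
          (ContinuousLinearMap.fst ℝ (ℝ × F) C(unitInterval, F))).smulRight c))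
    ((ContinuousLinearMap.fst ℝ (ℝ × F) C(unitInterval, F)).prod
      (ContinuousLinearMap.snd ℝ (ℝ × F) C(unitInterval, F) +
        ((ContinuousLinearMap.fst ℝ ℝ F).comp
          (ContinuousLinearMap.fst ℝ (ℝ × F) C(unitInterval, F))).smulRight c))
    (fun p => by ext <;> simp) (fun p => by ext <;> simp), ?_⟩
  refine h3.congr_fderiv ?_
  refine ContinuousLinearMap.ext fun p => ?_
  simp [hc]

/-- Smooth dependence on initial conditions, for a Lipschitz field: near `(0, y₀)` there is a
smooth function `Φ` which gives the value at time `ε` of every solution starting at `y`. -/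
lemma exists_contDiffAt_flow_of_lipschitz [CompleteSpace F] (X : F → F) (hX : ContDiff ℝ ∞ X)
    {K : NNReal} (hK : LipschitzWith K X) (y₀ : F) :
    ∃ Φ : ℝ × F → F, ∀ᶠ p in 𝓝 ((0 : ℝ), y₀), ContDiffAt ℝ ∞ Φ p ∧
      ∀ γ : ℝ → F, γ 0 = p.2 → (∀ s ∈ uIcc 0 p.1, HasDerivAt γ (X (γ s)) s) → Φ p = γ p.1 := by
  let Xc : C(F, F) := ⟨X, hX.continuous⟩
  have hT := contDiff_trajectoryMap Xc hX
  obtain ⟨e', he'⟩ := hasFDerivAt_trajectoryMap Xc hX y₀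
  let e := hT.contDiffAt.toOpenPartialHomeomorph (trajectoryMap Xc) he' (by simp)
  have hmem : ((0, y₀), 0) ∈ e.source :=
    hT.contDiffAt.mem_toOpenPartialHomeomorph_source he' (by simp)
  have he0 : e ((0, y₀), 0) = ((0, y₀), 0) := by
    change trajectoryMap Xc _ = _
    simp [trajectoryMap]
  have hsm := e.eventually_contDiffAt_symm hmem (fun x _ => hT.contDiffAt) e' he'
  have htgt := e.open_target.mem_nhds (e.map_source hmem)
  rw [he0] at hsm htgt
  have hj : Continuous fun p : ℝ × F => (p, (0 : C(unitInterval, F))) := by fun_prop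
  refine ⟨fun p => p.2 + (e.symm (p, 0)).2 1, ?_⟩
  filter_upwards [hj.continuousAt.eventually hsm, hj.continuousAt.eventually htgt]
    with p hp hpt
  constructor
  · have h1 : ContDiffAt ℝ ∞ (fun p : ℝ × F => e.symm (p, (0 : C(unitInterval, F)))) p :=
      ContDiffAt.comp p hp (contDiffAt_id.prodMk contDiffAt_const)
    have h2 : ContDiffAt ℝ ∞ (fun p : ℝ × F => (e.symm (p, (0 : C(unitInterval, F)))).2) p :=
      contDiffAt_snd.comp p h1
    exact contDiffAt_snd.add ((ContinuousMap.evalCLM ℝ (M := F)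
      (1 : unitInterval)).contDiff.contDiffAt.comp p h2)
  intro γ hγ0 hγ
  obtain ⟨ε, y⟩ := p
  set u := (e.symm ((ε, y), 0)).2 with hu
  have hinv : trajectoryMap Xc (e.symm ((ε, y), 0)) = ((ε, y), 0) := e.right_inv hpt
  have hfst : (e.symm ((ε, y), 0)).1 = (ε, y) := congrArg Prod.fst hinv
  have hsnd : u = ε • unitPrimitive F (Xc.comp (ContinuousMap.const _ y + u)) := by
    have := congrArg Prod.snd hinv
    simp only [trajectoryMap, hfst] at this
    exact sub_eq_zero.1 this
  -- the curve solving the rescaled equation, extended to the whole line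
  let g : ℝ → F := fun τ => X (y + u (projIcc 0 1 zero_le_one τ))
  have hg : Continuous g := hX.continuous.comp (by fun_prop)
  let z : ℝ → F := fun s => y + ε • ∫ τ in (0 : ℝ)..s, g τ
  have hz : ∀ s (hs : s ∈ Icc (0 : ℝ) 1), z s = y + u ⟨s, hs⟩ := by
    intro s hs
    conv_rhs => rw [hsnd]
    rfl
  have hz' : ∀ s ∈ Icc (0 : ℝ) 1, HasDerivAt z (ε • X (z s)) s := by
    intro s hs
    have h1 : HasDerivAt (fun s => ∫ τ in (0 : ℝ)..s, g τ) (g s) s :=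
      intervalIntegral.integral_hasDerivAt_right (hg.intervalIntegrable _ _)
        (hg.stronglyMeasurableAtFilter _ _) hg.continuousAt
    have h2 := (h1.const_smul ε).const_add y
    rw [hz s hs]
    have : g s = X (y + u ⟨s, hs⟩) := by simp only [g, projIcc_of_mem zero_le_one hs]
    rw [← this]
    exact h2
  have hγ' : ∀ s ∈ Icc (0 : ℝ) 1, HasDerivAt (fun s => γ (ε * s)) (ε • X (γ (ε * s))) s := by
    intro s hs
    have hmem : ε * s ∈ uIcc 0 ε := by
      rcases le_total 0 ε with h | h
      · rw [uIcc_of_le h]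
        exact ⟨mul_nonneg h hs.1, mul_le_of_le_one_right h hs.2⟩
      · rw [uIcc_of_ge h]
        exact ⟨by nlinarith [hs.2], mul_nonpos_of_nonpos_of_nonneg h hs.1⟩
    have h1 : HasDerivAt (fun s : ℝ => ε * s) ε s := by
      simpa using (hasDerivAt_id s).const_mul ε
    exact (hγ _ hmem).scomp s h1
  have huniq := ODE_solution_unique (v := fun _ x => ε • X x) (K := ‖ε‖₊ * K) (a := 0) (b := 1)
    (f := z) (g := fun s => γ (ε * s))
    (fun _ => (lipschitzWith_smul ε).comp hK)
    (fun s hs => (hz' s hs).continuousAt.continuousWithinAt)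
    (fun s hs => (hz' s ⟨hs.1, hs.2.le⟩).hasDerivWithinAt)
    (fun s hs => (hγ' s hs).continuousAt.continuousWithinAt)
    (fun s hs => (hγ' s ⟨hs.1, hs.2.le⟩).hasDerivWithinAt)
    (by simp [z, hγ0])
  have h1 := huniq (right_mem_Icc.2 zero_le_one)
  simp only [mul_one] at h1
  rw [hz 1 (right_mem_Icc.2 zero_le_one)] at h1
  exact h1

/-- **Smooth local flows.** A smooth vector field on an open set of a finite-dimensional space has
a local flow that depends smoothly on time and initial condition jointly. -/
theorem exists_contDiffOn_localFlow [FiniteDimensional ℝ F] {X : F → F} {Ω : Set F}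
    (hΩ : IsOpen Ω) (hX : ContDiffOn ℝ ∞ X Ω) {y₀ : F} (hy₀ : y₀ ∈ Ω) :
    ∃ Φ : ℝ × F → F, ∃ δ > 0, ∃ r > 0,
      ContDiffOn ℝ ∞ Φ (Ioo (-δ) δ ×ˢ Metric.ball y₀ r) ∧
      (∀ y ∈ Metric.ball y₀ r, Φ (0, y) = y) ∧
      ∀ t ∈ Ioo (-δ) δ, ∀ y ∈ Metric.ball y₀ r,
        Φ (t, y) ∈ Ω ∧ HasDerivAt (fun s => Φ (s, y)) (X (Φ (t, y))) t := by
  have : CompleteSpace F := FiniteDimensional.complete ℝ F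
  -- cut the field off outside a small ball
  obtain ⟨R, hR, hRΩ⟩ := Metric.isOpen_iff.1 hΩ y₀ hy₀
  let χ : ContDiffBump y₀ := ⟨R / 4, R / 2, by linarith, by linarith⟩
  let Y : F → F := fun x => χ x • X x
  have hYsupp : tsupport Y ⊆ Metric.closedBall y₀ (R / 2) := by
    have := tsupport_smul_subset_left χ X
    rw [χ.tsupport_eq] at this
    exact this
  have hYΩ : tsupport Y ⊆ Ω := hYsupp.trans
    ((Metric.closedBall_subset_ball (by linarith)).trans hRΩ)
  have hY : ContDiff ℝ ∞ Y := by
    refine contDiff_iff_contDiffAt.2 fun x => ?_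
    by_cases hx : x ∈ tsupport Y
    · exact χ.contDiff.contDiffAt.smul (hX.contDiffAt (hΩ.mem_nhds (hYΩ hx)))
    · exact contDiffAt_const.congr_of_eventuallyEq (notMem_tsupport_iff_eventuallyEq.1 hx)
  have hYc : HasCompactSupport Y :=
    HasCompactSupport.of_support_subset_isCompact (isCompact_closedBall y₀ (R / 2))
      ((subset_tsupport Y).trans hYsupp)
  obtain ⟨K, hK⟩ := hY.lipschitzWith_of_hasCompactSupport (𝕂 := ℝ) hYc (by simp)
  obtain ⟨Φ, hΦ⟩ := exists_contDiffAt_flow_of_lipschitz Y hY hK y₀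
  obtain ⟨ρ, hρ, ε, hε, hsol⟩ :=
    (hY.of_le (by simp) : ContDiff ℝ 1 Y).contDiffAt (x := y₀)
      |>.exists_forall_mem_closedBall_exists_eq_forall_mem_Ioo_hasDerivAt 0
  simp only [zero_sub, zero_add] at hsol
  -- restriction of a solution on `(-ε, ε)` to the time interval between `0` and `p.1`
  have hval : ∀ γ : ℝ → F, ∀ p : ℝ × F, p.1 ∈ Ioo (-ε) ε →
      (∀ t ∈ Ioo (-ε) ε, HasDerivAt γ (Y (γ t)) t) →
      ∀ s ∈ uIcc 0 p.1, HasDerivAt γ (Y (γ s)) s := fun γ p hp h s hs =>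
    h s ((ordConnected_Ioo.uIcc_subset ⟨by linarith, hε⟩ hp) hs)
  have h00 : Φ (0, y₀) = y₀ := by
    obtain ⟨γ, h0, hγ⟩ := hsol y₀ (Metric.mem_closedBall_self hρ.le)
    refine Eq.trans ?_ h0
    exact (mem_of_mem_nhds hΦ).2 γ h0 (hval γ (0, y₀) ⟨by simpa using hε, hε⟩ hγ)
  have hnear : ∀ᶠ p in 𝓝 ((0 : ℝ), y₀), Φ p ∈ Metric.ball y₀ (R / 4) := by
    refine (mem_of_mem_nhds hΦ).1.continuousAt.eventually ?_
    rw [h00]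
    exact Metric.ball_mem_nhds _ (by linarith)
  obtain ⟨δ, hδ, hboth⟩ := Metric.eventually_nhds_iff_ball.1 (hΦ.and hnear)
  have hball : ∀ t ∈ Ioo (-(min δ ε)) (min δ ε), ∀ y ∈ Metric.ball y₀ (min δ ρ),
      (t, y) ∈ Metric.ball ((0 : ℝ), y₀) δ := by
    intro t ht y hy
    rw [← ball_prod_same]
    refine ⟨?_, Metric.ball_subset_ball (min_le_left _ _) hy⟩
    rw [Metric.mem_ball, Real.dist_0_eq_abs, abs_lt]
    exact ⟨by linarith [ht.1, min_le_left δ ε], by linarith [ht.2, min_le_left δ ε]⟩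
  have hγ : ∀ y ∈ Metric.ball y₀ (min δ ρ), ∃ γ : ℝ → F, γ 0 = y ∧
      (∀ t ∈ Ioo (-(min δ ε)) (min δ ε), HasDerivAt γ (Y (γ t)) t) ∧
      ∀ t ∈ Ioo (-(min δ ε)) (min δ ε), Φ (t, y) = γ t := by
    intro y hy
    obtain ⟨γ, h0, hγ⟩ := hsol y
      (Metric.ball_subset_closedBall (Metric.ball_subset_ball (min_le_right _ _) hy))
    have hsub : Ioo (-(min δ ε)) (min δ ε) ⊆ Ioo (-ε) ε :=
      Ioo_subset_Ioo (neg_le_neg (min_le_right _ _)) (min_le_right _ _)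
    exact ⟨γ, h0, fun t ht => hγ t (hsub ht), fun t ht =>
      (hboth _ (hball t ht y hy)).1.2 γ h0 (hval γ (t, y) (hsub ht) hγ)⟩
  refine ⟨Φ, min δ ε, lt_min hδ hε, min δ ρ, lt_min hδ hρ, ?_, ?_, ?_⟩
  · rintro ⟨t, y⟩ ⟨ht, hy⟩
    exact (hboth _ (hball t ht y hy)).1.1.contDiffWithinAt
  · intro y hy
    obtain ⟨γ, h0, -, h⟩ := hγ y hy
    have hm : 0 < min δ ε := lt_min hδ hε
    rw [h 0 ⟨by linarith, hm⟩, h0]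
  · intro t ht y hy
    obtain ⟨γ, h0, hd, h⟩ := hγ y hy
    have hin := (hboth _ (hball t ht y hy)).2
    refine ⟨hRΩ (Metric.ball_subset_ball (by linarith) hin), ?_⟩
    have h1 : X (Φ (t, y)) = Y (γ t) := by
      have : χ (Φ (t, y)) = 1 := χ.one_of_mem_closedBall (Metric.ball_subset_closedBall hin)
      rw [← h t ht]
      simp [Y, this]
    rw [h1]
    refine (hd t ht).congr_of_eventuallyEq ?_
    filter_upwards [isOpen_Ioo.mem_nhds ht] with s hs using h s hs

end Flow

/-! ### First variation of the action -/

section FirstVariation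

variable {E : Type*} [NormedAddCommGroup E] [NormedSpace ℝ E]

/-- Equality of mixed partial derivatives: if `∂ₜ f = g` near `(t, y)`, then
`∂ₜ (D_y f) = D_y g` at `(t, y)`. -/
lemma hasDerivAt_fderiv_of_time_deriv {F G : Type*} [NormedAddCommGroup F] [NormedSpace ℝ F]
    [NormedAddCommGroup G] [NormedSpace ℝ G] {f g : ℝ × F → G} {t : ℝ} {y : F}
    (hf : ContDiffAt ℝ 2 f (t, y))
    (hg : ∀ᶠ p in 𝓝 (t, y), HasDerivAt (fun s => f (s, p.2)) (g p) p.1) (d : F) :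
    HasDerivAt (fun s => fderiv ℝ f (s, y) (0, d)) (fderiv ℝ g (t, y) (0, d)) t := by
  have hfd : ∀ᶠ p in 𝓝 (t, y), DifferentiableAt ℝ f p := by
    filter_upwards [hf.eventually (by simp)] with p hp using hp.differentiableAt (by simp)
  have hg' : g =ᶠ[𝓝 (t, y)] fun p => fderiv ℝ f p (1, 0) := by
    filter_upwards [hg, hfd] with p hp hpd
    have h1 : HasDerivAt (fun s : ℝ => (s, p.2)) ((1 : ℝ), (0 : F)) p.1 :=
      (hasDerivAt_id p.1).prodMk (hasDerivAt_const p.1 p.2)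
    exact hp.unique (hpd.hasFDerivAt.comp_hasDerivAt p.1 h1)
  have hD : DifferentiableAt ℝ (fderiv ℝ f) (t, y) :=
    (hf.fderiv_right (m := 1) (by norm_num)).differentiableAt (by simp)
  have hsymm : IsSymmSndFDerivAt ℝ f (t, y) := hf.isSymmSndFDerivAt (by simp)
  have h2 : fderiv ℝ g (t, y) (0, d) = fderiv ℝ (fderiv ℝ f) (t, y) (0, d) (1, 0) := by
    rw [hg'.fderiv_eq]
    rw [fderiv_clm_apply hD (differentiableAt_const _)]
    simp
  rw [h2, hsymm.eq]
  have h1 : HasDerivAt (fun s : ℝ => (s, y)) ((1 : ℝ), (0 : F)) t :=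
    (hasDerivAt_id t).prodMk (hasDerivAt_const t y)
  have h3 := hD.hasFDerivAt.comp_hasDerivAt t h1
  have h4 := h3.clm_apply (hasDerivAt_const t ((0 : ℝ), d))
  simpa using h4

/-- The partial derivative `∂ℓ/∂q` of a function of `(q, q̇)`. -/
noncomputable def positionPartial (ℓ : E × E → ℝ) (y : E × E) : E →L[ℝ] ℝ :=
  (fderiv ℝ ℓ y).comp (ContinuousLinearMap.inl ℝ E E)

/-- The partial derivative `∂ℓ/∂q̇` of a function of `(q, q̇)`. -/
noncomputable def velocityPartial (ℓ : E × E → ℝ) (y : E × E) : E →L[ℝ] ℝ :=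
  (fderiv ℝ ℓ y).comp (ContinuousLinearMap.inr ℝ E E)

lemma contDiffAt_velocityPartial {ℓ : E × E → ℝ} {y : E × E} (h : ContDiffAt ℝ ∞ ℓ y) :
    ContDiffAt ℝ ∞ (velocityPartial ℓ) y :=
  (h.fderiv_right (m := ∞) (by simp)).clm_comp contDiffAt_const

/-- A jointly smooth local flow `Φ` of the second order equation `q̈ = G(q, q̇)` near `y₀`, together
with the action `S(t, y) = ∫₀ᵗ ℓ(Φ(s, y)) ds` of a smooth function `ℓ` whose Euler-Lagrange
equations hold along the flow. -/
structure IsLagrangianFlow (ℓ : E × E → ℝ) (G : E × E → E) (Φ : ℝ × (E × E) → E × E)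
    (S : ℝ × (E × E) → ℝ) (y₀ : E × E) (δ r : ℝ) : Prop where
  time_pos : 0 < δ
  radius_pos : 0 < r
  contDiffOn_flow : ContDiffOn ℝ ∞ Φ (Ioo (-δ) δ ×ˢ Metric.ball y₀ r)
  contDiffOn_action : ContDiffOn ℝ ∞ S (Ioo (-δ) δ ×ˢ Metric.ball y₀ r)
  flow_zero : ∀ y ∈ Metric.ball y₀ r, Φ (0, y) = y
  action_zero : ∀ y ∈ Metric.ball y₀ r, S (0, y) = 0
  hasDerivAt_flow : ∀ t ∈ Ioo (-δ) δ, ∀ y ∈ Metric.ball y₀ r,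
    HasDerivAt (fun s => Φ (s, y)) ((Φ (t, y)).2, G (Φ (t, y))) t
  hasDerivAt_action : ∀ t ∈ Ioo (-δ) δ, ∀ y ∈ Metric.ball y₀ r,
    HasDerivAt (fun s => S (s, y)) (ℓ (Φ (t, y))) t
  contDiffAt_lagrangian : ∀ t ∈ Ioo (-δ) δ, ∀ y ∈ Metric.ball y₀ r, ContDiffAt ℝ ∞ ℓ (Φ (t, y))
  euler_lagrange : ∀ t ∈ Ioo (-δ) δ, ∀ y ∈ Metric.ball y₀ r,
    HasDerivAt (fun s => velocityPartial ℓ (Φ (s, y))) (positionPartial ℓ (Φ (t, y))) t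

namespace IsLagrangianFlow

variable {ℓ : E × E → ℝ} {G : E × E → E} {Φ : ℝ × (E × E) → E × E}
    {S : ℝ × (E × E) → ℝ} {y₀ : E × E} {δ r : ℝ}

lemma mono (h : IsLagrangianFlow ℓ G Φ S y₀ δ r) {δ' r' : ℝ} (hδ : 0 < δ') (hδ' : δ' ≤ δ)
    (hr : 0 < r') (hr' : r' ≤ r) : IsLagrangianFlow ℓ G Φ S y₀ δ' r' := by
  have h1 : Ioo (-δ') δ' ⊆ Ioo (-δ) δ := Ioo_subset_Ioo (neg_le_neg hδ') hδ'
  have h2 : Metric.ball y₀ r' ⊆ Metric.ball y₀ r := Metric.ball_subset_ball hr'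
  exact ⟨hδ, hr, h.contDiffOn_flow.mono (prod_mono h1 h2),
    h.contDiffOn_action.mono (prod_mono h1 h2), fun y hy => h.flow_zero y (h2 hy),
    fun y hy => h.action_zero y (h2 hy),
    fun t ht y hy => h.hasDerivAt_flow t (h1 ht) y (h2 hy),
    fun t ht y hy => h.hasDerivAt_action t (h1 ht) y (h2 hy),
    fun t ht y hy => h.contDiffAt_lagrangian t (h1 ht) y (h2 hy),
    fun t ht y hy => h.euler_lagrange t (h1 ht) y (h2 hy)⟩

lemma mem_nhds (_h : IsLagrangianFlow ℓ G Φ S y₀ δ r) {t : ℝ} (ht : t ∈ Ioo (-δ) δ) {y : E × E}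
    (hy : y ∈ Metric.ball y₀ r) : Ioo (-δ) δ ×ˢ Metric.ball y₀ r ∈ 𝓝 (t, y) :=
  (isOpen_Ioo.prod Metric.isOpen_ball).mem_nhds ⟨ht, hy⟩

lemma contDiffAt_flow (h : IsLagrangianFlow ℓ G Φ S y₀ δ r) {t : ℝ} (ht : t ∈ Ioo (-δ) δ)
    {y : E × E} (hy : y ∈ Metric.ball y₀ r) : ContDiffAt ℝ ∞ Φ (t, y) :=
  h.contDiffOn_flow.contDiffAt (h.mem_nhds ht hy)

lemma contDiffAt_action (h : IsLagrangianFlow ℓ G Φ S y₀ δ r) {t : ℝ} (ht : t ∈ Ioo (-δ) δ)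
    {y : E × E} (hy : y ∈ Metric.ball y₀ r) : ContDiffAt ℝ ∞ S (t, y) :=
  h.contDiffOn_action.contDiffAt (h.mem_nhds ht hy)

lemma zero_mem (h : IsLagrangianFlow ℓ G Φ S y₀ δ r) : (0 : ℝ) ∈ Ioo (-δ) δ :=
  ⟨neg_lt_zero.2 h.time_pos, h.time_pos⟩

/-- The spatial derivative of the flow at a fixed time is a slice of the full derivative. -/
lemma hasFDerivAt_slice {G' : Type*} [NormedAddCommGroup G'] [NormedSpace ℝ G']
    {f : ℝ × (E × E) → G'} {t : ℝ} {y : E × E} (hf : DifferentiableAt ℝ f (t, y)) :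
    HasFDerivAt (fun z => f (t, z))
      ((fderiv ℝ f (t, y)).comp (ContinuousLinearMap.inr ℝ ℝ (E × E))) y :=
  hf.hasFDerivAt.comp y (hasFDerivAt_prodMk_right t y)

/-- At time zero the spatial derivative of the flow is the identity. -/
lemma fderiv_flow_zero (h : IsLagrangianFlow ℓ G Φ S y₀ δ r) {y : E × E}
    (hy : y ∈ Metric.ball y₀ r) (d : E × E) : fderiv ℝ Φ (0, y) (0, d) = d := by
  have h1 := hasFDerivAt_slice ((h.contDiffAt_flow h.zero_mem hy).differentiableAt (by simp))
  have h2 : HasFDerivAt (fun z => Φ (0, z)) (ContinuousLinearMap.id ℝ (E × E)) y :=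
    (hasFDerivAt_id y).congr_of_eventuallyEq (by
      filter_upwards [Metric.isOpen_ball.mem_nhds hy] with z hz using h.flow_zero z hz)
  simpa using congrArg (fun A => A d) (h1.unique h2)

/-- **First variation of the action.** Along solutions of the Euler-Lagrange equations only the
boundary terms survive: `dS(t, ·) = ∂ℓ/∂q̇(Φ(t, y)) dq(t) - ∂ℓ/∂q̇(y) dq(0)`. -/
theorem fderiv_action (h : IsLagrangianFlow ℓ G Φ S y₀ δ r) {t : ℝ} (ht : t ∈ Ioo (-δ) δ)
    {y : E × E} (hy : y ∈ Metric.ball y₀ r) (d : E × E) :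
    fderiv ℝ S (t, y) (0, d) =
      velocityPartial ℓ (Φ (t, y)) (fderiv ℝ Φ (t, y) (0, d)).1 - velocityPartial ℓ y d.1 := by
  let w : ℝ → E × E := fun s => fderiv ℝ Φ (s, y) (0, d)
  have hΦt : ∀ s ∈ Ioo (-δ) δ, ∀ᶠ p : ℝ × (E × E) in 𝓝 (s, y),
      p.1 ∈ Ioo (-δ) δ ∧ p.2 ∈ Metric.ball y₀ r := fun s hs => h.mem_nhds hs hy
  -- variation of the action and of the position along the flow
  have hA : ∀ s ∈ Ioo (-δ) δ, HasDerivAt (fun s => fderiv ℝ S (s, y) (0, d))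
      (fderiv ℝ ℓ (Φ (s, y)) (w s)) s := by
    intro s hs
    have h1 := hasDerivAt_fderiv_of_time_deriv (g := fun p => ℓ (Φ p))
      ((h.contDiffAt_action hs hy).of_le (by norm_cast))
      (by filter_upwards [hΦt s hs] with p hp using h.hasDerivAt_action p.1 hp.1 p.2 hp.2) d
    have h2 : fderiv ℝ (fun p => ℓ (Φ p)) (s, y) =
        (fderiv ℝ ℓ (Φ (s, y))).comp (fderiv ℝ Φ (s, y)) :=
      fderiv_comp (s, y) ((h.contDiffAt_lagrangian s hs y hy).differentiableAt (by simp))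
        ((h.contDiffAt_flow hs hy).differentiableAt (by simp))
    rw [h2] at h1
    exact h1
  have hW : ∀ s ∈ Ioo (-δ) δ, HasDerivAt (fun s => (w s).1) (w s).2 s := by
    intro s hs
    have hd := (h.contDiffAt_flow hs hy)
    have hd1 : ∀ s ∈ Ioo (-δ) δ, fderiv ℝ (fun p => (Φ p).1) (s, y) =
        (ContinuousLinearMap.fst ℝ E E).comp (fderiv ℝ Φ (s, y)) := fun s hs =>
      (((h.contDiffAt_flow hs hy).differentiableAt (by simp)).hasFDerivAt.fst).fderiv
    have hd2 : fderiv ℝ (fun p => (Φ p).2) (s, y) =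
        (ContinuousLinearMap.snd ℝ E E).comp (fderiv ℝ Φ (s, y)) :=
      ((hd.differentiableAt (by simp)).hasFDerivAt.snd).fderiv
    have h1 := hasDerivAt_fderiv_of_time_deriv (f := fun p => (Φ p).1) (g := fun p => (Φ p).2)
      ((contDiffAt_fst.comp (s, y) hd).of_le (by norm_cast))
      (by filter_upwards [hΦt s hs] with p hp using (h.hasDerivAt_flow p.1 hp.1 p.2 hp.2).fst) d
    rw [hd2] at h1
    refine h1.congr_of_eventuallyEq ?_
    filter_upwards [isOpen_Ioo.mem_nhds hs] with s' hs'
    rw [hd1 s' hs']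
    rfl
  have hB : ∀ s ∈ Ioo (-δ) δ, HasDerivAt (fun s => velocityPartial ℓ (Φ (s, y)) (w s).1)
      (fderiv ℝ ℓ (Φ (s, y)) (w s)) s := by
    intro s hs
    refine ((h.euler_lagrange s hs y hy).clm_apply (hW s hs)).congr_deriv ?_
    simp only [positionPartial, velocityPartial, ContinuousLinearMap.comp_apply,
      ContinuousLinearMap.inl_apply, ContinuousLinearMap.inr_apply, ← map_add]
    simp
  have hconst : ∀ s ∈ Ioo (-δ) δ, HasDerivAt (fun s => fderiv ℝ S (s, y) (0, d) -
      velocityPartial ℓ (Φ (s, y)) (w s).1) 0 s := fun s hs =>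
    ((hA s hs).sub (hB s hs)).congr_deriv (sub_self _)
  have heq := isOpen_Ioo.is_const_of_deriv_eq_zero isPreconnected_Ioo
    (fun s hs => (hconst s hs).differentiableAt.differentiableWithinAt)
    (fun s hs => (hconst s hs).deriv) ht h.zero_mem
  -- at time zero the action vanishes and the flow is the identity
  have hS0 : fderiv ℝ S (0, y) (0, d) = 0 := by
    have h1 := hasFDerivAt_slice ((h.contDiffAt_action h.zero_mem hy).differentiableAt (by simp))
    have h2 : HasFDerivAt (fun z => S (0, z)) (0 : E × E →L[ℝ] ℝ) y :=
      (hasFDerivAt_const (0 : ℝ) y).congr_of_eventuallyEq (by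
        filter_upwards [Metric.isOpen_ball.mem_nhds hy] with z hz using h.action_zero z hz)
    simpa using congrArg (fun A => A d) (h1.unique h2)
  simp only [w, hS0, h.fderiv_flow_zero hy, h.flow_zero y hy] at heq
  linarith

end IsLagrangianFlow

end FirstVariation

/-! ### Uniform estimates for short times -/

section Estimates

variable {E : Type*} [NormedAddCommGroup E] [NormedSpace ℝ E]
  {ℓ : E × E → ℝ} {G : E × E → E} {Φ : ℝ × (E × E) → E × E}
  {S : ℝ × (E × E) → ℝ} {y₀ : E × E} {δ r : ℝ}

/-- The deviation of a trajectory from uniform motion, `q(t) - q(0) - t q̇(0)`. -/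
def deviation (Φ : ℝ × (E × E) → E × E) (t : ℝ) (y : E × E) : E :=
  (Φ (t, y)).1 - y.1 - t • y.2

/-- A smooth map is injective on the slices `{x} × E` near a point where its derivative is
injective on `{0} × E`. -/
lemma eventually_injOn_slices [FiniteDimensional ℝ E] {F : Type*} [NormedAddCommGroup F]
    [NormedSpace ℝ F] {f : E × E → F}
    (hf : ContDiffAt ℝ 1 f y₀) (hinj : ∀ e, fderiv ℝ f y₀ (0, e) = 0 → e = 0) :
    ∃ r > 0, ∀ y ∈ Metric.ball y₀ r, ∀ y' ∈ Metric.ball y₀ r, y.1 = y'.1 → f y = f y' →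
      y = y' := by
  -- `f` expands vertical differences at least by `1 / K`, up to an error of at most half of that
  let A : E →L[ℝ] F := (fderiv ℝ f y₀).comp (ContinuousLinearMap.inr ℝ E E)
  have hA : LinearMap.ker (A : E →ₗ[ℝ] F) = ⊥ := by
    rw [LinearMap.ker_eq_bot']
    exact fun e he => hinj e he
  obtain ⟨K, hK, hanti⟩ := LinearMap.exists_antilipschitzWith (A : E →ₗ[ℝ] F) hA
  have hstrict := hf.hasStrictFDerivAt (by simp)
  have hc : 0 < ((2 : NNReal) * K)⁻¹ := by positivity
  obtain ⟨s, hs, happ⟩ := hstrict.approximates_deriv_on_nhds (c := (2 * K)⁻¹) (Or.inr hc)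
  obtain ⟨r, hr, hrs⟩ := Metric.mem_nhds_iff.1 hs
  refine ⟨r, hr, fun y hy y' hy' h1 h2 => ?_⟩
  have h3 := happ y (hrs hy) y' (hrs hy')
  have hd : y - y' = (0, y.2 - y'.2) := Prod.ext (by simp [h1]) rfl
  have hn : ‖y - y'‖ = ‖y.2 - y'.2‖ := by rw [hd, Prod.norm_mk, norm_zero]; simp
  have h4 : ‖y.2 - y'.2‖ ≤ K * ‖A (y.2 - y'.2)‖ := by
    have := hanti.le_mul_dist y.2 y'.2
    rw [dist_eq_norm, dist_eq_norm, ← map_sub] at this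
    exact this
  have h5 : ‖A (y.2 - y'.2)‖ ≤ (2 * K)⁻¹ * ‖y.2 - y'.2‖ := by
    rw [h2, sub_self, zero_sub, norm_neg, hn, hd] at h3
    exact_mod_cast h3
  have hK' : (0 : ℝ) < K := hK
  have h6 : ‖y.2 - y'.2‖ ≤ (1 / 2) * ‖y.2 - y'.2‖ := by
    calc _ ≤ K * ‖A (y.2 - y'.2)‖ := h4
      _ ≤ K * ((2 * K)⁻¹ * ‖y.2 - y'.2‖) := by gcongr
      _ = (1 / 2) * ‖y.2 - y'.2‖ := by
          rw [NNReal.coe_inv, NNReal.coe_mul, NNReal.coe_two]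
          field_simp
  have h7 : ‖y.2 - y'.2‖ = 0 := by linarith [norm_nonneg (y.2 - y'.2)]
  exact Prod.ext h1 (sub_eq_zero.1 (norm_eq_zero.1 h7))

namespace IsLagrangianFlow

lemma hasDerivAt_deviation (h : IsLagrangianFlow ℓ G Φ S y₀ δ r) {t : ℝ} (ht : t ∈ Ioo (-δ) δ)
    {y : E × E} (hy : y ∈ Metric.ball y₀ r) :
    HasDerivAt (fun s => deviation Φ s y) ((Φ (t, y)).2 - y.2) t := by
  have h1 : HasDerivAt (fun s => (Φ (s, y)).1) (Φ (t, y)).2 t := (h.hasDerivAt_flow t ht y hy).fst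
  exact ((h1.sub_const y.1).sub ((hasDerivAt_id t).smul_const y.2)).congr_deriv (by simp)

lemma deviation_zero (h : IsLagrangianFlow ℓ G Φ S y₀ δ r) {y : E × E}
    (hy : y ∈ Metric.ball y₀ r) : deviation Φ 0 y = 0 := by
  simp [deviation, h.flow_zero y hy]

/-- For short times, the change of velocity is a contraction of the initial condition. -/
lemma exists_norm_velocity_sub_le (h : IsLagrangianFlow ℓ G Φ S y₀ δ r) :
    ∃ ε > 0, ∀ t ∈ Ioo (-ε) ε, ∀ y ∈ Metric.ball y₀ ε, ∀ y' ∈ Metric.ball y₀ ε,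
      ‖((Φ (t, y)).2 - y.2) - ((Φ (t, y')).2 - y'.2)‖ ≤ 1 / 2 * ‖y - y'‖ := by
  let D : ℝ × (E × E) → (E × E →L[ℝ] E) := fun p =>
    (ContinuousLinearMap.snd ℝ E E).comp
      ((fderiv ℝ Φ p).comp (ContinuousLinearMap.inr ℝ ℝ (E × E))) - ContinuousLinearMap.snd ℝ E E
  have hy₀ := Metric.mem_ball_self (x := y₀) h.radius_pos
  have hcont : ContinuousAt D (0, y₀) := by
    have h1 : ContinuousAt (fderiv ℝ Φ) (0, y₀) :=
      ((h.contDiffAt_flow h.zero_mem hy₀).fderiv_right (m := 0) (by simp)).continuousAt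
    exact (continuousAt_const.clm_comp (h1.clm_comp continuousAt_const)).sub continuousAt_const
  have hD0 : D (0, y₀) = 0 := by
    ext d <;> simp [D, h.fderiv_flow_zero hy₀]
  have hsmall : ∀ᶠ p in 𝓝 ((0 : ℝ), y₀), ‖D p‖ ≤ 1 / 2 := by
    have := hcont.norm.eventually (p := fun x => x ≤ (1 / 2 : ℝ)) (by
      beta_reduce
      rw [hD0, norm_zero]
      exact Iic_mem_nhds (by norm_num))
    exact this
  obtain ⟨ε, hε, hball⟩ := Metric.eventually_nhds_iff_ball.1
    (hsmall.and (h.mem_nhds h.zero_mem hy₀))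
  refine ⟨ε, hε, fun t ht y hy y' hy' => ?_⟩
  have hp : ∀ z ∈ Metric.ball y₀ ε, (t, z) ∈ Metric.ball ((0 : ℝ), y₀) ε := by
    intro z hz
    rw [← ball_prod_same]
    refine ⟨?_, hz⟩
    rw [Metric.mem_ball, Real.dist_0_eq_abs, abs_lt]
    exact ht
  refine (convex_ball y₀ ε).norm_image_sub_le_of_norm_hasFDerivWithin_le
    (f := fun z => (Φ (t, z)).2 - z.2) (f' := fun z => D (t, z)) (fun z hz => ?_)
    (fun z hz => (hball _ (hp z hz)).1) hy' hy
  have hz' := (hball _ (hp z hz)).2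
  have h1 := hasFDerivAt_slice ((h.contDiffAt_flow hz'.1 hz'.2).differentiableAt (by simp))
  exact (h1.snd.sub hasFDerivAt_snd).hasFDerivWithinAt

end IsLagrangianFlow

/-- A Lagrangian flow on `(-δ, δ) × B(y₀, r')` with `δ` and `r'` so small that the exponential maps
and the Legendre transformation are injective on `B(y₀, r')`, and that `B(y₀, r)` stays inside
`B(y₀, r')`. The bound on the deviation at `y₀` keeps the trajectories from `y₀` within a small
fraction of the radius `h r / 16` of the balls used as ranges of the exponential map. -/
structure IsSmallLagrangianFlow (ℓ : E × E → ℝ) (G : E × E → E) (Φ : ℝ × (E × E) → E × E)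
    (S : ℝ × (E × E) → ℝ) (y₀ : E × E) (δ r r' : ℝ) : Prop
    extends IsLagrangianFlow ℓ G Φ S y₀ δ r' where
  inner_pos : 0 < r
  inner_le : r ≤ r'
  mapsTo_flow : ∀ t ∈ Ioo (-δ) δ, ∀ y ∈ Metric.ball y₀ r, Φ (t, y) ∈ Metric.ball y₀ r'
  norm_deviation_sub_le : ∀ t ∈ Ico 0 δ, ∀ y ∈ Metric.ball y₀ r', ∀ y' ∈ Metric.ball y₀ r',
    ‖deviation Φ t y - deviation Φ t y'‖ ≤ t / 2 * ‖y - y'‖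
  norm_deviation_le : ∀ t ∈ Ico 0 δ, ‖deviation Φ t y₀‖ ≤ t * (r / 256)
  legendre_injective : ∀ y ∈ Metric.ball y₀ r', ∀ y' ∈ Metric.ball y₀ r', y.1 = y'.1 →
    velocityPartial ℓ y = velocityPartial ℓ y' → y = y'
  nondegenerate : ∀ y ∈ Metric.ball y₀ r', ∀ e : E,
    (∀ f, fderiv ℝ (velocityPartial ℓ) y (0, e) f = 0) → e = 0

/-- Every Lagrangian flow of a regular Lagrangian near a point of zero velocity becomes small after
shrinking its domain. -/
lemma IsLagrangianFlow.exists_small [FiniteDimensional ℝ E]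
    (h : IsLagrangianFlow ℓ G Φ S y₀ δ r)
    (hnd : ∀ y ∈ Metric.ball y₀ r, ∀ e : E,
      (∀ f, fderiv ℝ (velocityPartial ℓ) y (0, e) f = 0) → e = 0) :
    ∃ δ' r₁ r₂, δ' ≤ δ ∧ r₂ ≤ r ∧ IsSmallLagrangianFlow ℓ G Φ S y₀ δ' r₁ r₂ := by
  have hy₀ := Metric.mem_ball_self (x := y₀) h.radius_pos
  obtain ⟨ε, hε, hvel⟩ := h.exists_norm_velocity_sub_le
  have hℓ : ContDiffAt ℝ ∞ ℓ y₀ := by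
    have := h.contDiffAt_lagrangian 0 h.zero_mem y₀ hy₀
    rwa [h.flow_zero y₀ hy₀] at this
  obtain ⟨ρ, hρ, hleg⟩ := eventually_injOn_slices (f := velocityPartial ℓ)
    ((contDiffAt_velocityPartial hℓ).of_le (by simp)) (fun e he => hnd y₀ hy₀ e (by simp [he]))
  set r₂ := min r (min ε ρ) with hr₂
  have hr₂pos : 0 < r₂ := lt_min h.radius_pos (lt_min hε hρ)
  have hr₂r : r₂ ≤ r := min_le_left _ _
  have hr₂ε : r₂ ≤ ε := (min_le_right _ _).trans (min_le_left _ _)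
  have hr₂ρ : r₂ ≤ ρ := (min_le_right _ _).trans (min_le_right _ _)
  have hflow : ContinuousAt Φ (0, y₀) := (h.contDiffAt_flow h.zero_mem hy₀).continuousAt
  have hev1 : ∀ᶠ p in 𝓝 ((0 : ℝ), y₀), Φ p ∈ Metric.ball y₀ r₂ := by
    refine hflow.eventually ?_
    rw [h.flow_zero y₀ hy₀]
    exact Metric.ball_mem_nhds _ hr₂pos
  obtain ⟨κ, hκ, hmap⟩ := Metric.eventually_nhds_iff_ball.1 hev1
  set r₁ := min κ r₂ with hr₁
  have hr₁pos : 0 < r₁ := lt_min hκ hr₂pos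
  have hev2 : ∀ᶠ t in 𝓝 (0 : ℝ), ‖(Φ (t, y₀)).2 - y₀.2‖ ≤ r₁ / 256 := by
    have h1 : ContinuousAt (fun t : ℝ => ‖(Φ (t, y₀)).2 - y₀.2‖) 0 := by
      have h2 : ContinuousAt (fun t : ℝ => Φ (t, y₀)) 0 :=
        ContinuousAt.comp (f := fun t : ℝ => (t, y₀)) hflow (by fun_prop)
      exact (h2.snd.sub continuousAt_const).norm
    refine h1.eventually (p := fun x => x ≤ r₁ / 256) ?_
    beta_reduce
    rw [h.flow_zero y₀ hy₀, sub_self, norm_zero]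
    exact Iic_mem_nhds (by positivity)
  obtain ⟨τ, hτ, hstart⟩ := Metric.eventually_nhds_iff_ball.1 hev2
  set δ' := min (min δ ε) (min κ τ) with hδ'
  have hδ'pos : 0 < δ' := lt_min (lt_min h.time_pos hε) (lt_min hκ hτ)
  have hδ'δ : δ' ≤ δ := (min_le_left _ _).trans (min_le_left _ _)
  have hδ'ε : δ' ≤ ε := (min_le_left _ _).trans (min_le_right _ _)
  have hδ'κ : δ' ≤ κ := (min_le_right _ _).trans (min_le_left _ _)
  have hδ'τ : δ' ≤ τ := (min_le_right _ _).trans (min_le_right _ _)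
  have h' := h.mono hδ'pos hδ'δ hr₂pos hr₂r
  refine ⟨δ', r₁, r₂, hδ'δ, hr₂r, { h' with
    inner_pos := hr₁pos
    inner_le := min_le_right _ _
    mapsTo_flow := fun t ht y hy => hmap (t, y) ?_
    norm_deviation_sub_le := fun t ht y hy y' hy' => ?_
    norm_deviation_le := fun t ht => ?_
    legendre_injective := fun y hy y' hy' => hleg y (Metric.ball_subset_ball hr₂ρ hy) y'
      (Metric.ball_subset_ball hr₂ρ hy')
    nondegenerate := fun y hy => hnd y (Metric.ball_subset_ball hr₂r hy) }⟩
  · rw [← ball_prod_same]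
    refine ⟨?_, Metric.ball_subset_ball (min_le_left _ _) hy⟩
    rw [Metric.mem_ball, Real.dist_0_eq_abs, abs_lt]
    exact ⟨by linarith [ht.1], by linarith [ht.2]⟩
  · have hin : ∀ s ∈ Icc 0 t, s ∈ Ioo (-δ') δ' := fun s hs =>
      ⟨by linarith [hs.1], by linarith [hs.2, ht.2]⟩
    have key := norm_image_sub_le_of_norm_deriv_le_segment' (a := 0) (b := t)
      (f := fun s => deviation Φ s y - deviation Φ s y') (C := 1 / 2 * ‖y - y'‖)
      (fun s hs => ((h'.hasDerivAt_deviation (hin s hs) hy).sub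
        (h'.hasDerivAt_deviation (hin s hs) hy')).hasDerivWithinAt)
      (fun s hs => hvel s ⟨by linarith [hs.1], by linarith [hs.2, ht.2]⟩ y
        (Metric.ball_subset_ball hr₂ε hy) y' (Metric.ball_subset_ball hr₂ε hy'))
      t (right_mem_Icc.2 ht.1)
    rw [h'.deviation_zero hy, h'.deviation_zero hy'] at key
    simp only [sub_self, sub_zero] at key
    linarith
  · have hc := Metric.mem_ball_self (x := y₀) hr₂pos
    have hin : ∀ s ∈ Icc 0 t, s ∈ Ioo (-δ') δ' := fun s hs =>
      ⟨by linarith [hs.1], by linarith [hs.2, ht.2]⟩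
    have key := norm_image_sub_le_of_norm_deriv_le_segment' (a := 0) (b := t)
      (f := fun s => deviation Φ s y₀) (C := r₁ / 256)
      (fun s hs => (h'.hasDerivAt_deviation (hin s hs) hc).hasDerivWithinAt)
      (fun s hs => hstart s (by
        rw [Metric.mem_ball, Real.dist_0_eq_abs, abs_of_nonneg hs.1]
        linarith [hs.2, ht.2]))
      t (right_mem_Icc.2 ht.1)
    rw [h'.deviation_zero hc] at key
    simp only [sub_zero] at key
    linarith

end Estimates

/-! ### The exponential map in coordinates -/

section LocalExponential

variable {E : Type*} [NormedAddCommGroup E] [NormedSpace ℝ E]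
  {ℓ : E × E → ℝ} {G : E × E → E} {Φ : ℝ × (E × E) → E × E}
  {S : ℝ × (E × E) → ℝ} {y₀ : E × E} {δ r r' : ℝ}

/-- The exponential map `(q, q̇) ↦ (q, q(h))` of a flow in coordinates. -/
def localExp (Φ : ℝ × (E × E) → E × E) (h : ℝ) (y : E × E) : E × E := (y.1, (Φ (h, y)).1)

namespace IsSmallLagrangianFlow

lemma ball_subset (H : IsSmallLagrangianFlow ℓ G Φ S y₀ δ r r') :
    Metric.ball y₀ r ⊆ Metric.ball y₀ r' := Metric.ball_subset_ball H.inner_le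

/-- Two trajectories of the small flow with the same end points at times `0` and `h` coincide. -/
lemma localExp_injOn (H : IsSmallLagrangianFlow ℓ G Φ S y₀ δ r r') {h : ℝ} (h0 : 0 < h)
    (hδ : h < δ) : InjOn (localExp Φ h) (Metric.ball y₀ r') := by
  intro y hy y' hy' heq
  have h1 : y.1 = y'.1 := (congrArg Prod.fst heq :)
  have h2 : (Φ (h, y)).1 = (Φ (h, y')).1 := (congrArg Prod.snd heq :)
  have h3 := H.norm_deviation_sub_le h ⟨h0.le, hδ⟩ y hy y' hy'
  have h4 : deviation Φ h y - deviation Φ h y' = -(h • (y.2 - y'.2)) := by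
    simp only [deviation, h1, h2, smul_sub]
    abel
  have h5 : ‖y - y'‖ = ‖y.2 - y'.2‖ := by
    rw [Prod.norm_def]
    simp [h1]
  rw [h4, norm_neg, norm_smul, Real.norm_of_nonneg h0.le, h5] at h3
  have h6 : ‖y.2 - y'.2‖ = 0 := by
    by_contra hne
    have : 0 < ‖y.2 - y'.2‖ := lt_of_le_of_ne (norm_nonneg _) (Ne.symm hne)
    nlinarith [mul_pos h0 this]
  exact Prod.ext h1 (sub_eq_zero.1 (norm_eq_zero.1 h6))

lemma mem_time {h : ℝ} (h0 : 0 < h) (hδ : h < δ) : h ∈ Ioo (-δ) δ := ⟨by linarith, hδ⟩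

lemma contDiffAt_localExp (H : IsSmallLagrangianFlow ℓ G Φ S y₀ δ r r') {h : ℝ} (h0 : 0 < h)
    (hδ : h < δ) {y : E × E} (hy : y ∈ Metric.ball y₀ r') :
    ContDiffAt ℝ ∞ (localExp Φ h) y := by
  have h1 : ContDiffAt ℝ ∞ (fun z => Φ (h, z)) y :=
    (H.contDiffAt_flow (mem_time h0 hδ) hy).comp y (contDiffAt_const.prodMk contDiffAt_id)
  exact contDiffAt_fst.prodMk h1.fst

/-- The derivative of the exponential map is injective, because the deviation from uniform motion
contracts distances by the factor `h / 2`. -/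
lemma exists_equiv_hasFDerivAt_localExp [FiniteDimensional ℝ E]
    (H : IsSmallLagrangianFlow ℓ G Φ S y₀ δ r r') {h : ℝ} (h0 : 0 < h)
    (hδ : h < δ) {y : E × E} (hy : y ∈ Metric.ball y₀ r') :
    ∃ e' : (E × E) ≃L[ℝ] (E × E), HasFDerivAt (localExp Φ h) (e' : E × E →L[ℝ] E × E) y := by
  have hd := ((H.contDiffAt_localExp h0 hδ hy).differentiableAt (by simp)).hasFDerivAt
  set D := fderiv ℝ (localExp Φ h) y with hD
  have hfst : ∀ d, (D d).1 = d.1 := fun d =>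
    congrArg (fun A => A d) (hd.fst.unique hasFDerivAt_fst)
  have hdev : HasFDerivAt (deviation Φ h)
      ((ContinuousLinearMap.snd ℝ E E).comp D - ContinuousLinearMap.fst ℝ E E -
        h • ContinuousLinearMap.snd ℝ E E) y :=
    (hd.snd.sub hasFDerivAt_fst).sub (hasFDerivAt_snd.const_smul h)
  have hbound := hdev.le_of_lip' (C := h / 2) (by linarith) (by
    filter_upwards [Metric.isOpen_ball.mem_nhds hy] with z hz
    exact H.norm_deviation_sub_le h ⟨h0.le, hδ⟩ z hz y hy)
  have hinj : Function.Injective (D : E × E →ₗ[ℝ] E × E) := by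
    rw [← LinearMap.ker_eq_bot, LinearMap.ker_eq_bot']
    intro d hDd
    have hDd' : D d = 0 := hDd
    have h1 : d.1 = 0 := by rw [← hfst, hDd']; rfl
    have h2 := ContinuousLinearMap.le_of_opNorm_le _ hbound d
    have h3 : ‖d‖ = ‖d.2‖ := by rw [Prod.norm_def]; simp [h1]
    simp only [sub_apply, ContinuousLinearMap.comp_apply, hDd', h1,
      smul_apply, ContinuousLinearMap.coe_fst', ContinuousLinearMap.coe_snd',
      Prod.snd_zero, sub_zero, zero_sub, norm_neg, norm_smul, Real.norm_of_nonneg h0.le, h3] at h2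
    have h6 : ‖d.2‖ = 0 := by
      by_contra hne
      have : 0 < ‖d.2‖ := lt_of_le_of_ne (norm_nonneg _) (Ne.symm hne)
      nlinarith [mul_pos h0 this]
    exact Prod.ext h1 (norm_eq_zero.1 h6)
  let L := LinearEquiv.ofInjectiveEndo (D : E × E →ₗ[ℝ] E × E) hinj
  refine ⟨L.toContinuousLinearEquiv, hd.congr_fderiv ?_⟩
  ext d <;> rfl

/-- A map inverting the exponential map with values in the domain of injectivity is smooth. -/
lemma contDiffOn_of_localExp_rightInverse [FiniteDimensional ℝ E]
    (H : IsSmallLagrangianFlow ℓ G Φ S y₀ δ r r') {h : ℝ} (h0 : 0 < h) (hδ : h < δ)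
    {V : Set (E × E)} (hV : IsOpen V) {ρ : E × E → E × E} (hρ : MapsTo ρ V (Metric.ball y₀ r'))
    (hinv : ∀ p ∈ V, localExp Φ h (ρ p) = p) : ContDiffOn ℝ ∞ ρ V := by
  have : CompleteSpace E := FiniteDimensional.complete ℝ E
  intro p hp
  obtain ⟨e', he'⟩ := H.exists_equiv_hasFDerivAt_localExp h0 hδ (hρ hp)
  have hsm := H.contDiffAt_localExp h0 hδ (hρ hp)
  let e := hsm.toOpenPartialHomeomorph (localExp Φ h) he' (by simp)
  have hmem : ρ p ∈ e.source := hsm.mem_toOpenPartialHomeomorph_source he' (by simp)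
  have hep : e (ρ p) = p := hinv p hp
  have hpt : p ∈ e.target := hep ▸ e.map_source hmem
  have hsymm : e.symm p = ρ p := by rw [← hep, e.left_inv hmem, hep]
  have hcd : ContDiffAt ℝ ∞ e.symm p :=
    e.contDiffAt_symm hpt (f₀' := e') (by rw [hsymm]; exact he') (by rw [hsymm]; exact hsm)
  have hball : ∀ᶠ q in 𝓝 p, e.symm q ∈ Metric.ball y₀ r' :=
    hcd.continuousAt.eventually (by
      rw [hsymm]; exact Metric.isOpen_ball.mem_nhds (hρ hp))
  refine (hcd.congr_of_eventuallyEq ?_).contDiffWithinAt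
  filter_upwards [hball, e.open_target.mem_nhds hpt, hV.mem_nhds hp] with q hq hqt hqV
  exact H.localExp_injOn h0 hδ (hρ hqV) hq ((hinv q hqV).trans (e.right_inv hqt).symm)

/-- The exponential map at time `h` reaches all pairs of points at distance of order `h`. -/
lemma exists_localExp_eq [FiniteDimensional ℝ E]
    (H : IsSmallLagrangianFlow ℓ G Φ S y₀ δ r r') (hy₀ : y₀.2 = 0) {h : ℝ}
    (h0 : 0 < h) (hδ : h < δ) (hδ1 : h ≤ 1) {p : E × E}
    (h1 : p.1 ∈ Metric.ball y₀.1 (h * (r / 16))) (h2 : p.2 ∈ Metric.ball y₀.1 (h * (r / 16))) :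
    ∃ y ∈ Metric.ball y₀ r, localExp Φ h y = p := by
  have : CompleteSpace E := FiniteDimensional.complete ℝ E
  have hr := H.inner_pos
  -- the exponential map with the difference of end points rescaled is close to the identity
  let ψ : E × E → E × E := fun y => (y.1, h⁻¹ • ((Φ (h, y)).1 - y.1))
  have hψ : ∀ y, ψ y = y + (0, h⁻¹ • deviation Φ h y) := by
    intro y
    ext1
    · simp [ψ]
    · simp only [ψ, deviation, Prod.snd_add, smul_sub, inv_smul_smul₀ h0.ne']
      abel
  have happ : ApproximatesLinearOn ψ (ContinuousLinearMap.id ℝ (E × E)) (Metric.ball y₀ r)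
      (1 / 2) := by
    intro y hy y' hy'
    have h3 := H.norm_deviation_sub_le h ⟨h0.le, hδ⟩ y (H.ball_subset hy) y' (H.ball_subset hy')
    have h4 : ψ y - ψ y' - (ContinuousLinearMap.id ℝ (E × E)) (y - y') =
        (0, h⁻¹ • (deviation Φ h y - deviation Φ h y')) := by
      rw [hψ, hψ]
      ext1 <;> simp [smul_sub]
      abel
    rw [h4, Prod.norm_mk, norm_zero, norm_smul, norm_inv, Real.norm_of_nonneg h0.le,
      max_eq_right (by positivity)]
    calc _ ≤ h⁻¹ * (h / 2 * ‖y - y'‖) := by gcongr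
      _ = (1 / 2 : NNReal) * ‖y - y'‖ := by push_cast; field_simp
  let inv : (ContinuousLinearMap.id ℝ (E × E)).NonlinearRightInverse :=
    { toFun := id
      nnnorm := 1
      bound' := fun y => by simp
      right_inv' := fun y => rfl }
  have hsurj := happ.surjOn_closedBall_of_nonlinearRightInverse inv (ε := r / 2) (b := y₀)
    (by linarith) (Metric.closedBall_subset_ball (by linarith))
  have hdev0 : ‖h⁻¹ • deviation Φ h y₀‖ ≤ r / 256 := by
    rw [norm_smul, norm_inv, Real.norm_of_nonneg h0.le]
    calc _ ≤ h⁻¹ * (h * (r / 256)) := by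
          gcongr
          exact H.norm_deviation_le h ⟨h0.le, hδ⟩
      _ = r / 256 := by field_simp
  rw [mem_ball_iff_norm] at h1 h2
  -- the rescaled target is within `r / 8 + r / 256` of the image of `y₀`, less than `r / 4`
  have hmem : (p.1, h⁻¹ • (p.2 - p.1)) ∈
      Metric.closedBall (ψ y₀) (((inv.nnnorm : ℝ)⁻¹ - (1 / 2 : NNReal)) * (r / 2)) := by
    have hrad : ((inv.nnnorm : ℝ)⁻¹ - (1 / 2 : NNReal)) * (r / 2) = r / 4 := by
      simp only [inv, NNReal.coe_one]
      push_cast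
      ring
    rw [hrad, mem_closedBall_iff_norm, hψ]
    have hsub : ((p.1, h⁻¹ • (p.2 - p.1)) : E × E) - (y₀ + (0, h⁻¹ • deviation Φ h y₀)) =
        (p.1 - y₀.1, h⁻¹ • ((p.2 - y₀.1) - (p.1 - y₀.1)) - h⁻¹ • deviation Φ h y₀) := by
      ext1 <;> simp [hy₀]
    rw [hsub, Prod.norm_mk]
    refine max_le ?_ ?_
    · nlinarith
    · have h3 : ‖h⁻¹ • ((p.2 - y₀.1) - (p.1 - y₀.1))‖ ≤ r / 8 := by
        rw [norm_smul, norm_inv, Real.norm_of_nonneg h0.le]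
        calc _ ≤ h⁻¹ * (h * (r / 16) + h * (r / 16)) := by
              gcongr
              exact (norm_sub_le _ _).trans (add_le_add h2.le h1.le)
          _ = r / 8 := by field_simp; ring
      linarith [norm_sub_le (h⁻¹ • ((p.2 - y₀.1) - (p.1 - y₀.1))) (h⁻¹ • deviation Φ h y₀)]
  obtain ⟨y, hy, hyp⟩ := hsurj hmem
  refine ⟨y, Metric.closedBall_subset_ball (by linarith) hy, ?_⟩
  have hy1 : y.1 = p.1 := (congrArg Prod.fst hyp :)
  have hy2 : h⁻¹ • ((Φ (h, y)).1 - y.1) = h⁻¹ • (p.2 - p.1) := (congrArg Prod.snd hyp :)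
  have hy3 := smul_right_injective E (inv_ne_zero h0.ne') hy2
  simp only [hy1] at hy3
  exact Prod.ext hy1 (sub_left_injective hy3)

/-- Following for time `2 h` the trajectory which returns to its starting point after time `h`
leads to a point at distance much smaller than `h`. -/
lemma flow_two_mul_mem_ball (H : IsSmallLagrangianFlow ℓ G Φ S y₀ δ r r') (hy₀ : y₀.2 = 0)
    {h : ℝ} (h0 : 0 < h) (hδ : 2 * h < δ) {y : E × E} (hy : y ∈ Metric.ball y₀ r')
    (hexp : localExp Φ h y = (y₀.1, y₀.1)) :
    (Φ (2 * h, y)).1 ∈ Metric.ball y₀.1 (h * (r / 16)) := by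
  have hr := H.inner_pos
  have hc : y₀ ∈ Metric.ball y₀ r' := Metric.mem_ball_self H.radius_pos
  have h1 : y.1 = y₀.1 := (congrArg Prod.fst hexp :)
  have h2 : (Φ (h, y)).1 = y₀.1 := (congrArg Prod.snd hexp :)
  have hn : ‖y - y₀‖ = ‖y.2‖ := by
    rw [Prod.norm_def]
    simp [h1, hy₀]
  have hd1 : deviation Φ h y = -(h • y.2) := by simp [deviation, h1, h2]
  have e1 := H.norm_deviation_sub_le h ⟨h0.le, by linarith⟩ y hy y₀ hc
  have e2 := H.norm_deviation_sub_le (2 * h) ⟨by linarith, hδ⟩ y hy y₀ hc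
  have e3 := H.norm_deviation_le h ⟨h0.le, by linarith⟩
  have e4 := H.norm_deviation_le (2 * h) ⟨by linarith, hδ⟩
  rw [hn] at e1 e2
  -- the initial velocity is at most `2 r / 256`, so that the total is at most `8 h r / 256`
  have f1 : h * ‖y.2‖ ≤ h * (r / 256) + h / 2 * ‖y.2‖ := by
    have : ‖deviation Φ h y‖ = h * ‖y.2‖ := by
      rw [hd1, norm_neg, norm_smul, Real.norm_of_nonneg h0.le]
    linarith [norm_le_norm_add_norm_sub' (deviation Φ h y) (deviation Φ h y₀)]
  have f2 : (Φ (2 * h, y)).1 - y₀.1 = deviation Φ (2 * h) y₀ +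
      (deviation Φ (2 * h) y - deviation Φ (2 * h) y₀) + (2 * h) • y.2 := by
    simp [deviation, h1]
  rw [mem_ball_iff_norm, f2]
  have f3 : ‖(2 * h) • y.2‖ = 2 * (h * ‖y.2‖) := by
    rw [norm_smul, Real.norm_of_nonneg (by linarith)]
    ring
  have f4 := norm_add₃_le (a := deviation Φ (2 * h) y₀)
    (b := deviation Φ (2 * h) y - deviation Φ (2 * h) y₀) (c := (2 * h) • y.2)
  nlinarith [mul_pos h0 hr]

end IsSmallLagrangianFlow

end LocalExponential

/-! ### The exact discrete Lagrangian in coordinates -/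

section DiscreteLagrangian

variable {E : Type*} [NormedAddCommGroup E] [NormedSpace ℝ E]
  {ℓ : E × E → ℝ} {G : E × E → E} {Φ : ℝ × (E × E) → E × E}
  {S : ℝ × (E × E) → ℝ} {y₀ : E × E} {δ r r' h : ℝ} {O : Set E} {ρ : E × E → E × E}

namespace IsSmallLagrangianFlow

/-- A local inverse `ρ` of the exponential map is smooth, and an infinitesimal change `d` of the end
points gives a trajectory whose end points vary by `d.1` and `d.2`. -/
lemma contDiffAt_inverse_and_fderiv [FiniteDimensional ℝ E]
    (H : IsSmallLagrangianFlow ℓ G Φ S y₀ δ r r') (h0 : 0 < h)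
    (hδ : h < δ) (hO : IsOpen O) (hρ : MapsTo ρ (O ×ˢ O) (Metric.ball y₀ r))
    (hinv : ∀ p ∈ O ×ˢ O, localExp Φ h (ρ p) = p) {p : E × E} (hp : p ∈ O ×ˢ O) :
    ContDiffAt ℝ ∞ ρ p ∧ ∀ d : E × E, (fderiv ℝ ρ p d).1 = d.1 ∧
      (fderiv ℝ Φ (h, ρ p) (0, fderiv ℝ ρ p d)).1 = d.2 := by
  have hV := hO.prod hO
  have hsm := (H.contDiffOn_of_localExp_rightInverse h0 hδ hV
    (hρ.mono_right H.ball_subset) hinv).contDiffAt (hV.mem_nhds hp)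
  refine ⟨hsm, fun d => ?_⟩
  have hd := (hsm.differentiableAt (by simp)).hasFDerivAt
  have hΦ := IsLagrangianFlow.hasFDerivAt_slice
    ((H.contDiffAt_flow (mem_time h0 hδ) (H.ball_subset (hρ hp))).differentiableAt (by simp))
  have hnear := hV.mem_nhds hp
  constructor
  · have h1 : HasFDerivAt (fun q : E × E => q.1)
        ((ContinuousLinearMap.fst ℝ E E).comp (fderiv ℝ ρ p)) p :=
      hd.fst.congr_of_eventuallyEq (by
        filter_upwards [hnear] with q hq using (congrArg Prod.fst (hinv q hq) :).symm)
    exact congrArg (fun A => A d) (h1.unique hasFDerivAt_fst)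
  · have h1 := (hΦ.comp p hd).fst.congr_of_eventuallyEq (f₁ := fun q : E × E => q.2) (by
        filter_upwards [hnear] with q hq using (congrArg Prod.snd (hinv q hq) :).symm)
    exact congrArg (fun A => A d) (h1.unique hasFDerivAt_snd)

/-- The exact discrete Lagrangian `(a, b) ↦ S(h, ρ(a, b))` generates the discrete flow: its
differential is the momentum at the end point minus the momentum at the starting point. -/
theorem hasFDerivAt_discreteLagrangian [FiniteDimensional ℝ E]
    (H : IsSmallLagrangianFlow ℓ G Φ S y₀ δ r r') (h0 : 0 < h)
    (hδ : h < δ) (hO : IsOpen O) (hρ : MapsTo ρ (O ×ˢ O) (Metric.ball y₀ r))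
    (hinv : ∀ p ∈ O ×ˢ O, localExp Φ h (ρ p) = p) {p : E × E} (hp : p ∈ O ×ˢ O) :
    HasFDerivAt (fun q => S (h, ρ q))
      ((velocityPartial ℓ (Φ (h, ρ p))).comp (ContinuousLinearMap.snd ℝ E E) -
        (velocityPartial ℓ (ρ p)).comp (ContinuousLinearMap.fst ℝ E E)) p := by
  obtain ⟨hsm, hder⟩ := H.contDiffAt_inverse_and_fderiv h0 hδ hO hρ hinv hp
  have hS := IsLagrangianFlow.hasFDerivAt_slice
    ((H.contDiffAt_action (mem_time h0 hδ) (H.ball_subset (hρ hp))).differentiableAt (by simp))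
  refine (hS.comp p (hsm.differentiableAt (by simp)).hasFDerivAt).congr_fderiv ?_
  refine ContinuousLinearMap.ext fun d => ?_
  have := H.fderiv_action (mem_time h0 hδ) (H.ball_subset (hρ hp)) (fderiv ℝ ρ p d)
  rw [(hder d).1, (hder d).2] at this
  exact this

lemma hasFDerivAt_discreteLagrangian_left [FiniteDimensional ℝ E]
    (H : IsSmallLagrangianFlow ℓ G Φ S y₀ δ r r')
    (h0 : 0 < h) (hδ : h < δ) (hO : IsOpen O) (hρ : MapsTo ρ (O ×ˢ O) (Metric.ball y₀ r))
    (hinv : ∀ p ∈ O ×ˢ O, localExp Φ h (ρ p) = p) {a b : E} (ha : a ∈ O) (hb : b ∈ O) :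
    HasFDerivAt (fun x => S (h, ρ (x, b))) (-velocityPartial ℓ (ρ (a, b))) a := by
  refine (HasFDerivAt.comp (g := fun q => S (h, ρ q)) a
    (H.hasFDerivAt_discreteLagrangian h0 hδ hO hρ hinv (p := (a, b)) ⟨ha, hb⟩)
    (hasFDerivAt_prodMk_left a b)).congr_fderiv ?_
  ext d
  simp

lemma hasFDerivAt_discreteLagrangian_right [FiniteDimensional ℝ E]
    (H : IsSmallLagrangianFlow ℓ G Φ S y₀ δ r r')
    (h0 : 0 < h) (hδ : h < δ) (hO : IsOpen O) (hρ : MapsTo ρ (O ×ˢ O) (Metric.ball y₀ r))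
    (hinv : ∀ p ∈ O ×ˢ O, localExp Φ h (ρ p) = p) {a b : E} (ha : a ∈ O) (hb : b ∈ O) :
    HasFDerivAt (fun x => S (h, ρ (a, x))) (velocityPartial ℓ (Φ (h, ρ (a, b)))) b := by
  refine (HasFDerivAt.comp (g := fun q => S (h, ρ q)) b
    (H.hasFDerivAt_discreteLagrangian h0 hδ hO hρ hinv (p := (a, b)) ⟨ha, hb⟩)
    (hasFDerivAt_prodMk_right a b)).congr_fderiv ?_
  ext d
  simp

lemma contDiffAt_lagrangian_inner (H : IsSmallLagrangianFlow ℓ G Φ S y₀ δ r r') {y : E × E}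
    (hy : y ∈ Metric.ball y₀ r') : ContDiffAt ℝ ∞ ℓ y := by
  have := H.contDiffAt_lagrangian 0 H.zero_mem y hy
  rwa [H.flow_zero y hy] at this

lemma differentiableAt_momentum [FiniteDimensional ℝ E]
    (H : IsSmallLagrangianFlow ℓ G Φ S y₀ δ r r')
    (h0 : 0 < h) (hδ : h < δ) (hO : IsOpen O) (hρ : MapsTo ρ (O ×ˢ O) (Metric.ball y₀ r))
    (hinv : ∀ p ∈ O ×ˢ O, localExp Φ h (ρ p) = p) {p : E × E} (hp : p ∈ O ×ˢ O) :
    DifferentiableAt ℝ (fun q => velocityPartial ℓ (ρ q)) p := by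
  obtain ⟨hsm, -⟩ := H.contDiffAt_inverse_and_fderiv h0 hδ hO hρ hinv hp
  have hℓ := H.contDiffAt_lagrangian_inner (H.ball_subset (hρ hp))
  exact ((contDiffAt_velocityPartial hℓ).differentiableAt (by simp)).comp p
    (hsm.differentiableAt (by simp))

/-- Regularity of the exact discrete Lagrangian: `D₁₂` is, up to sign, the velocity Hessian of `ℓ`
composed with the invertible derivative of the initial velocity in the end point. -/
theorem discreteLagrangian_nondegenerate [FiniteDimensional ℝ E]
    (H : IsSmallLagrangianFlow ℓ G Φ S y₀ δ r r')
    (h0 : 0 < h) (hδ : h < δ) (hO : IsOpen O) (hρ : MapsTo ρ (O ×ˢ O) (Metric.ball y₀ r))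
    (hinv : ∀ p ∈ O ×ˢ O, localExp Φ h (ρ p) = p) {a b : E} (ha : a ∈ O) (hb : b ∈ O) {w : E}
    (hw : ∀ u, fderiv ℝ (fun x => -velocityPartial ℓ (ρ (a, x)) w) b u = 0) : w = 0 := by
  have hp : (a, b) ∈ O ×ˢ O := ⟨ha, hb⟩
  obtain ⟨hsm, hder⟩ := H.contDiffAt_inverse_and_fderiv h0 hδ hO hρ hinv hp
  have hℓ := H.contDiffAt_lagrangian_inner (H.ball_subset (hρ hp))
  have hρd : HasFDerivAt (fun x => ρ (a, x))
      ((fderiv ℝ ρ (a, b)).comp (ContinuousLinearMap.inr ℝ E E)) b :=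
    (hsm.differentiableAt (by simp)).hasFDerivAt.comp b (hasFDerivAt_prodMk_right a b)
  have hvp := ((contDiffAt_velocityPartial hℓ).differentiableAt (by simp)).hasFDerivAt
  have hcomp := (hvp.comp b hρd).clm_apply (hasFDerivAt_const w b)
  have hfd : ∀ u, fderiv ℝ (fun x => -velocityPartial ℓ (ρ (a, x)) w) b u =
      -(fderiv ℝ (velocityPartial ℓ) (ρ (a, b)) (fderiv ℝ ρ (a, b) (0, u)) w) := by
    intro u
    have h1 : fderiv ℝ (fun x => -velocityPartial ℓ (ρ (a, x)) w) b = _ := hcomp.neg.fderiv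
    rw [h1]
    simp
  -- the velocity component of the derivative of `ρ` in the second slot is onto
  let B : E →ₗ[ℝ] E := (ContinuousLinearMap.snd ℝ E E).comp
    ((fderiv ℝ ρ (a, b)).comp (ContinuousLinearMap.inr ℝ E E))
  have hBr : ∀ u, fderiv ℝ ρ (a, b) (0, u) = (0, B u) := fun u =>
    Prod.ext (hder (0, u)).1 rfl
  have hBinj : Function.Injective B := by
    rw [← LinearMap.ker_eq_bot, LinearMap.ker_eq_bot']
    intro u hu
    have h1 := (hder (0, u)).2
    rw [hBr, hu, show ((0 : ℝ), ((0 : E), (0 : E))) = 0 from rfl, map_zero] at h1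
    exact h1.symm
  have hBsurj := LinearMap.injective_iff_surjective.1 hBinj
  refine H.nondegenerate _ (H.ball_subset (hρ hp)) w fun f => ?_
  obtain ⟨u, rfl⟩ := hBsurj f
  have h1 := hw u
  rw [hfd, hBr, neg_eq_zero] at h1
  have hsymm : IsSymmSndFDerivAt ℝ ℓ (ρ (a, b)) :=
    (hℓ.of_le (m := 2) (by norm_cast)).isSymmSndFDerivAt (by simp)
  have hD : DifferentiableAt ℝ (fderiv ℝ ℓ) (ρ (a, b)) :=
    (hℓ.fderiv_right (m := ∞) (by simp)).differentiableAt (by simp)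
  have hvv : ∀ d e, fderiv ℝ (velocityPartial ℓ) (ρ (a, b)) d e =
      fderiv ℝ (fderiv ℝ ℓ) (ρ (a, b)) d (0, e) := by
    intro d e
    have := hD.hasFDerivAt.clm_comp
      (hasFDerivAt_const (ContinuousLinearMap.inr ℝ E E) (ρ (a, b)))
    have h2 : fderiv ℝ (velocityPartial ℓ) (ρ (a, b)) = _ := this.fderiv
    rw [h2]
    simp
  rw [hvv] at h1 ⊢
  rw [hsymm.eq]
  exact h1

/-- The discrete Euler-Lagrange equations of the exact discrete Lagrangian say that the momenta
match, hence that consecutive arcs belong to one trajectory. -/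
theorem discrete_eulerLagrange_iff (H : IsSmallLagrangianFlow ℓ G Φ S y₀ δ r r') (h0 : 0 < h)
    (hδ : h < δ) (hρ : MapsTo ρ (O ×ˢ O) (Metric.ball y₀ r))
    (hinv : ∀ p ∈ O ×ˢ O, localExp Φ h (ρ p) = p) {a b c : E} (ha : a ∈ O) (hb : b ∈ O)
    (hc : c ∈ O) (hadd : Φ (2 * h, ρ (a, b)) = Φ (h, Φ (h, ρ (a, b)))) :
    (Φ (2 * h, ρ (a, b))).1 = c ↔
      -velocityPartial ℓ (ρ (b, c)) + velocityPartial ℓ (Φ (h, ρ (a, b))) = 0 := by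
  have hab : (a, b) ∈ O ×ˢ O := ⟨ha, hb⟩
  have hbc : (b, c) ∈ O ×ˢ O := ⟨hb, hc⟩
  have hw := H.mapsTo_flow h (mem_time h0 hδ) _ (hρ hab)
  have hw1 : (Φ (h, ρ (a, b))).1 = b := (congrArg Prod.snd (hinv _ hab) :)
  have hv1 : (ρ (b, c)).1 = b := (congrArg Prod.fst (hinv _ hbc) :)
  have hv2 : (Φ (h, ρ (b, c))).1 = c := (congrArg Prod.snd (hinv _ hbc) :)
  rw [hadd, neg_add_eq_zero]
  constructor
  · intro heq
    rw [H.localExp_injOn h0 hδ (H.ball_subset (hρ hbc)) hw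
      (Prod.ext (hv1.trans hw1.symm) (hv2.trans heq.symm))]
  · intro heq
    rw [← H.legendre_injective _ (H.ball_subset (hρ hbc)) _ hw (hv1.trans hw1.symm) heq, hv2]

end IsSmallLagrangianFlow

end DiscreteLagrangian

/-! ### Second order fields in the natural charts of the tangent bundle -/

section TangentChart

variable {E : Type*} [NormedAddCommGroup E] [NormedSpace ℝ E]
  {Q : Type*} [TopologicalSpace Q] [ChartedSpace E Q] [IsManifold 𝓘(ℝ, E) ∞ Q]

/-- The natural chart `(x, v)` of `TQ` induced by the chart of `Q` at `q₀`. -/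
noncomputable abbrev tangentChart (E : Type*) [NormedAddCommGroup E] [NormedSpace ℝ E]
    {Q : Type*} [TopologicalSpace Q] [ChartedSpace E Q] [IsManifold 𝓘(ℝ, E) ∞ Q] (q₀ : Q) :
    PartialEquiv (TangentBundle 𝓘(ℝ, E) Q) (E × E) :=
  extChartAt 𝓘(ℝ, E).tangent (⟨q₀, 0⟩ : TangentBundle 𝓘(ℝ, E) Q)

lemma tangentChart_target (q₀ : Q) :
    (tangentChart E q₀).target = (extChartAt 𝓘(ℝ, E) q₀).target ×ˢ univ := by
  rw [tangentChart, FiberBundle.extChartAt]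
  ext ⟨x, v⟩
  simp only [mfld_simps]
  constructor
  · exact fun h => h.1
  · exact fun h => ⟨h, (chartAt E q₀).map_target h⟩

lemma mem_tangentChart_source {q₀ : Q} {v : TangentBundle 𝓘(ℝ, E) Q} :
    v ∈ (tangentChart E q₀).source ↔ v.proj ∈ (chartAt E q₀).source := by
  rw [tangentChart, extChartAt_source]
  simp [TangentBundle.mem_chart_source_iff]

/-- The second component of the natural chart is the tangent vector in the frame of the chart. -/
lemma tangentChart_snd {q₀ : Q} {v : TangentBundle 𝓘(ℝ, E) Q}
    (hv : v.proj ∈ (chartAt E q₀).source) :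
    (tangentChart E q₀ v).2 = mfderiv 𝓘(ℝ, E) 𝓘(ℝ, E) (extChartAt 𝓘(ℝ, E) q₀) v.proj v.snd := by
  have h1 := mfderiv_chartAt_eq_tangentCoordChange (I := 𝓘(ℝ, E)) hv
  have h2 : (tangentChart E q₀ v).2 = tangentCoordChange 𝓘(ℝ, E) v.proj q₀ v.proj v.snd := rfl
  rw [h2, ← h1]
  rfl

/-- The first component of a vector tangent to `TQ`, read in the natural chart, is its projection
to `TQ` read in the chart of `Q`. -/
lemma mfderiv_tangentChart_proj {q₀ : Q} {v : TangentBundle 𝓘(ℝ, E) Q}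
    (hv : v.proj ∈ (chartAt E q₀).source) (ξ : TangentSpace 𝓘(ℝ, E).tangent v) :
    (mfderiv 𝓘(ℝ, E).tangent 𝓘(ℝ, E × E) (tangentChart E q₀) v ξ).1 =
      mfderiv 𝓘(ℝ, E) 𝓘(ℝ, E) (extChartAt 𝓘(ℝ, E) q₀) v.proj
        (mfderiv 𝓘(ℝ, E).tangent 𝓘(ℝ, E)
          (fun w : TangentBundle 𝓘(ℝ, E) Q => w.proj) v ξ) := by
  have hv' : v ∈ (chartAt (ModelProd E E) (⟨q₀, 0⟩ : TangentBundle 𝓘(ℝ, E) Q)).source := by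
    simpa [TangentBundle.mem_chart_source_iff] using hv
  have h1 : HasMFDerivAt 𝓘(ℝ, E).tangent 𝓘(ℝ, E × E) (tangentChart E q₀) v _ :=
    (mdifferentiableAt_extChartAt (I := 𝓘(ℝ, E).tangent) hv').hasMFDerivAt
  have h2 : HasMFDerivAt 𝓘(ℝ, E × E) 𝓘(ℝ, E) (Prod.fst : E × E → E) (tangentChart E q₀ v)
      (ContinuousLinearMap.fst ℝ E E) := hasFDerivAt_fst.hasMFDerivAt
  have h3 := h2.comp v h1
  have h4 : HasMFDerivAt 𝓘(ℝ, E).tangent 𝓘(ℝ, E)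
      (fun w : TangentBundle 𝓘(ℝ, E) Q => w.proj) v _ :=
    ((Bundle.contMDiff_proj (n := 1) (IB := 𝓘(ℝ, E)) (F := E)
      (TangentSpace 𝓘(ℝ, E) (M := Q))).mdifferentiable (by simp) v).hasMFDerivAt
  have h5 : HasMFDerivAt 𝓘(ℝ, E) 𝓘(ℝ, E) (extChartAt 𝓘(ℝ, E) q₀) v.proj _ :=
    (mdifferentiableAt_extChartAt hv).hasMFDerivAt
  have h6 := h5.comp v h4
  exact congrArg (fun A : TangentSpace 𝓘(ℝ, E).tangent v →L[ℝ] E => A ξ)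
    (hasMFDerivAt_unique h3 h6)

/-- The vector field `Γ` in the natural chart of `TQ` at `q₀`. -/
noncomputable def localField
    (Γ : (v : TangentBundle 𝓘(ℝ, E) Q) → TangentSpace 𝓘(ℝ, E).tangent v) (q₀ : Q)
    (y : E × E) : E × E :=
  mfderiv 𝓘(ℝ, E).tangent 𝓘(ℝ, E × E) (tangentChart E q₀) ((tangentChart E q₀).symm y)
    (Γ ((tangentChart E q₀).symm y))

lemma IsSODE.localField_fst {Γ : (v : TangentBundle 𝓘(ℝ, E) Q) → TangentSpace 𝓘(ℝ, E).tangent v}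
    (hΓ : IsSODE Γ) {q₀ : Q} {y : E × E} (hy : y ∈ (tangentChart E q₀).target) :
    (localField Γ q₀ y).1 = y.2 := by
  have h1 := mem_tangentChart_source.1 ((tangentChart E q₀).map_target hy)
  rw [localField, mfderiv_tangentChart_proj h1, hΓ.second_order]
  refine (tangentChart_snd h1).symm.trans ?_
  rw [(tangentChart E q₀).right_inv hy]

lemma IsSODE.contDiffOn_localField
    {Γ : (v : TangentBundle 𝓘(ℝ, E) Q) → TangentSpace 𝓘(ℝ, E).tangent v}
    (hΓ : IsSODE Γ) (q₀ : Q) : ContDiffOn ℝ ∞ (localField Γ q₀) (tangentChart E q₀).target := by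
  let p : TangentBundle 𝓘(ℝ, E) Q := ⟨q₀, 0⟩
  let e := trivializationAt (E × E) (TangentSpace 𝓘(ℝ, E).tangent (M := TangentBundle 𝓘(ℝ, E) Q)) p
  have h1 := (e.contMDiffOn_section_baseSet_iff (n := ∞) (IB := 𝓘(ℝ, E).tangent) (s := Γ)).1
    hΓ.smooth.contMDiffOn
  have hbase : e.baseSet = (tangentChart E q₀).source := by
    rw [tangentChart, extChartAt_source]
    rfl
  have h2 : ContMDiffOn 𝓘(ℝ, E × E) 𝓘(ℝ, E × E) ∞
      ((fun x => (e ⟨x, Γ x⟩).2) ∘ (tangentChart E q₀).symm) (tangentChart E q₀).target := by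
    refine h1.comp (contMDiffOn_extChartAt_symm p) ?_
    rw [hbase]
    exact fun y hy => (tangentChart E q₀).map_target hy
  refine h2.contDiffOn.congr fun y hy => ?_
  have hs : (tangentChart E q₀).symm y ∈ (chartAt (ModelProd E E) p).source := by
    have := (tangentChart E q₀).map_target hy
    rwa [tangentChart, extChartAt_source] at this
  have h3 := mfderiv_chartAt_eq_tangentCoordChange (I := 𝓘(ℝ, E).tangent) hs
  exact congrArg (fun A : E × E →L[ℝ] E × E => A (Γ ((tangentChart E q₀).symm y))) h3

/-- The image under the inverse chart of a solution of the equation in coordinates is an integral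
curve of `Γ`. -/
lemma hasMFDerivAt_tangentChart_symm_comp
    {Γ : (v : TangentBundle 𝓘(ℝ, E) Q) → TangentSpace 𝓘(ℝ, E).tangent v}
    {q₀ : Q} {γ : ℝ → E × E} {t : ℝ} (hγt : γ t ∈ (tangentChart E q₀).target)
    (hγ : HasDerivAt γ (localField Γ q₀ (γ t)) t) :
    HasMFDerivAt 𝓘(ℝ, ℝ) 𝓘(ℝ, E).tangent ((tangentChart E q₀).symm ∘ γ) t
      ((1 : ℝ →L[ℝ] ℝ).smulRight (Γ ((tangentChart E q₀).symm (γ t)))) := by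
  have h1 : HasMFDerivAt 𝓘(ℝ, ℝ) 𝓘(ℝ, E × E) γ t
      ((1 : ℝ →L[ℝ] ℝ).smulRight (localField Γ q₀ (γ t))) := hγ.hasFDerivAt.hasMFDerivAt
  have h2 : HasMFDerivWithinAt 𝓘(ℝ, E × E) 𝓘(ℝ, E).tangent (tangentChart E q₀).symm
      (range 𝓘(ℝ, E).tangent) (γ t) _ :=
    (mdifferentiableWithinAt_extChartAt_symm hγt).hasMFDerivWithinAt
  have h2' : HasMFDerivAt 𝓘(ℝ, E × E) 𝓘(ℝ, E).tangent (tangentChart E q₀).symm (γ t) _ :=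
    h2.hasMFDerivAt (by simp)
  refine (h2'.comp t h1).congr_mfderiv ?_
  have h3 := mfderivWithin_extChartAt_symm_comp_mfderiv_extChartAt (I := 𝓘(ℝ, E).tangent) hγt
  have h4 := congrArg (fun A => A (Γ ((tangentChart E q₀).symm (γ t)))) h3
  refine ContinuousLinearMap.ext fun (s : ℝ) => ?_
  have h5 : mfderivWithin 𝓘(ℝ, E × E) 𝓘(ℝ, E).tangent (tangentChart E q₀).symm
      (range 𝓘(ℝ, E).tangent) (γ t) (localField Γ q₀ (γ t)) =
      Γ ((tangentChart E q₀).symm (γ t)) := h4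
  change mfderivWithin 𝓘(ℝ, E × E) 𝓘(ℝ, E).tangent (tangentChart E q₀).symm
      (range 𝓘(ℝ, E).tangent) (γ t) (s • localField Γ q₀ (γ t)) =
      s • Γ ((tangentChart E q₀).symm (γ t))
  rw [← h5]
  exact map_smul _ s _

/-- The tangent bundle of a Hausdorff manifold is Hausdorff; this is what makes integral curves
in it unique. -/
lemma t2Space_tangentBundle [T2Space Q] : T2Space (TangentBundle 𝓘(ℝ, E) Q) := by
  have hproj : Continuous (fun v : TangentBundle 𝓘(ℝ, E) Q => v.proj) :=
    FiberBundle.continuous_proj E (TangentSpace 𝓘(ℝ, E) (M := Q))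
  refine ⟨fun v w hvw => ?_⟩
  by_cases h : v.proj = w.proj
  · have hsrc : ∀ u : TangentBundle 𝓘(ℝ, E) Q, u.proj = w.proj →
        u ∈ (tangentChart E w.proj).source := fun u hu => by
      rw [mem_tangentChart_source, hu]
      exact mem_chart_source E w.proj
    have hne : tangentChart E w.proj v ≠ tangentChart E w.proj w := fun heq =>
      hvw ((tangentChart E w.proj).injOn (hsrc v h) (hsrc w rfl) heq)
    obtain ⟨A, B, hA, hB, hvA, hwB, hAB⟩ := t2_separation hne
    refine ⟨_, _, (continuousOn_extChartAt _).isOpen_inter_preimage (isOpen_extChartAt_source _) hA,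
      (continuousOn_extChartAt _).isOpen_inter_preimage (isOpen_extChartAt_source _) hB,
      ⟨hsrc v h, hvA⟩, ⟨hsrc w rfl, hwB⟩, ?_⟩
    exact (hAB.preimage _).mono inter_subset_right inter_subset_right
  · obtain ⟨A, B, hA, hB, hvA, hwB, hAB⟩ := t2_separation h
    exact ⟨_, _, hA.preimage hproj, hB.preimage hproj, hvA, hwB, hAB.preimage _⟩

end TangentChart

/-! ### The flow of a variational second order field near a zero vector -/

section VariationalFlow

variable {E : Type*} [NormedAddCommGroup E] [NormedSpace ℝ E]
  {Q : Type*} [TopologicalSpace Q] [ChartedSpace E Q] [IsManifold 𝓘(ℝ, E) ∞ Q]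
  {Γ : (v : TangentBundle 𝓘(ℝ, E) Q) → TangentSpace 𝓘(ℝ, E).tangent v}

lemma sodeFlow_zero (hc : IsCompleteField Γ) (v : TangentBundle 𝓘(ℝ, E) Q) :
    sodeFlow hc 0 v = v := (hc v).choose_spec.1

lemma isMIntegralCurve_sodeFlow (hc : IsCompleteField Γ) (v : TangentBundle 𝓘(ℝ, E) Q) :
    IsMIntegralCurve (fun t => sodeFlow hc t v) Γ := (hc v).choose_spec.2

lemma sodeFlow_add [CompleteSpace E] [T2Space Q] (hΓ : IsSODE Γ) (hc : IsCompleteField Γ)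
    (s t : ℝ) (v : TangentBundle 𝓘(ℝ, E) Q) :
    sodeFlow hc (t + s) v = sodeFlow hc t (sodeFlow hc s v) := by
  have : T2Space (TangentBundle 𝓘(ℝ, E) Q) := t2Space_tangentBundle
  have h1 := (isMIntegralCurve_sodeFlow hc v).comp_add s
  have h2 := isMIntegralCurve_sodeFlow hc (sodeFlow hc s v)
  exact congrFun (isMIntegralCurve_Ioo_eq_of_contMDiff_boundaryless (t₀ := 0)
    (hΓ.smooth.of_le (by simp)) h1 h2 (by simp [sodeFlow_zero])) t

/-- An integral curve of `Γ` on an open interval around `0` agrees with the flow. -/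
lemma sodeFlow_eqOn [CompleteSpace E] [T2Space Q] (hΓ : IsSODE Γ) (hc : IsCompleteField Γ)
    {δ : ℝ} (hδ : 0 < δ) {γ : ℝ → TangentBundle 𝓘(ℝ, E) Q}
    (hγ : IsMIntegralCurveOn γ Γ (Ioo (-δ) δ)) :
    EqOn (fun t => sodeFlow hc t (γ 0)) γ (Ioo (-δ) δ) := by
  have : T2Space (TangentBundle 𝓘(ℝ, E) Q) := t2Space_tangentBundle
  exact isMIntegralCurveOn_Ioo_eqOn_of_contMDiff_boundaryless (t₀ := 0) ⟨by linarith, hδ⟩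
    (hΓ.smooth.of_le (by simp)) ((isMIntegralCurve_sodeFlow hc (γ 0)).isMIntegralCurveOn _) hγ
    (sodeFlow_zero hc _)

/-- The base curve of an integral curve of a SODE has the integral curve as velocity. -/
lemma IsSODE.velocityLift_proj (hΓ : IsSODE Γ) {γ : ℝ → TangentBundle 𝓘(ℝ, E) Q} {t : ℝ}
    (hγ : HasMFDerivAt 𝓘(ℝ, ℝ) 𝓘(ℝ, E).tangent γ t ((1 : ℝ →L[ℝ] ℝ).smulRight (Γ (γ t)))) :
    velocityLift (E := E) (fun s => (γ s).proj) t = γ t := by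
  have h1 : HasMFDerivAt 𝓘(ℝ, E).tangent 𝓘(ℝ, E)
      (fun w : TangentBundle 𝓘(ℝ, E) Q => w.proj) (γ t) _ :=
    ((Bundle.contMDiff_proj (n := 1) (IB := 𝓘(ℝ, E)) (F := E)
      (TangentSpace 𝓘(ℝ, E) (M := Q))).mdifferentiable (by simp) (γ t)).hasMFDerivAt
  have h2 := (h1.comp t hγ).mfderiv
  have h3 := congrArg (fun A => A (1 : ℝ)) h2
  have h4 : mfderiv 𝓘(ℝ, ℝ) 𝓘(ℝ, E) (fun s => (γ s).proj) t (1 : ℝ) = (γ t).snd := by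
    refine h3.trans ?_
    rw [← hΓ.second_order]
    change mfderiv 𝓘(ℝ, E).tangent 𝓘(ℝ, E) (fun w : TangentBundle 𝓘(ℝ, E) Q => w.proj) (γ t)
      ((1 : ℝ) • Γ (γ t)) = _
    rw [one_smul]
  change (⟨(γ t).proj, _⟩ : TangentBundle 𝓘(ℝ, E) Q) = ⟨(γ t).proj, (γ t).snd⟩
  rw [h4]

lemma dLdv_eq_velocityPartial {L : TangentBundle 𝓘(ℝ, E) Q → ℝ} {q₀ : Q} {y : E × E}
    (h : DifferentiableAt ℝ (fun z => L ((tangentChart E q₀).symm z)) y) :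
    dLdv L q₀ y.1 y.2 = velocityPartial (fun z => L ((tangentChart E q₀).symm z)) y :=
  (HasFDerivAt.comp (g := fun z => L ((tangentChart E q₀).symm z)) y.2 h.hasFDerivAt
    (hasFDerivAt_prodMk_right y.1 y.2)).fderiv

lemma dLdq_eq_positionPartial {L : TangentBundle 𝓘(ℝ, E) Q → ℝ} {q₀ : Q} {y : E × E}
    (h : DifferentiableAt ℝ (fun z => L ((tangentChart E q₀).symm z)) y) :
    dLdq L q₀ y.1 y.2 = positionPartial (fun z => L ((tangentChart E q₀).symm z)) y :=
  (HasFDerivAt.comp (g := fun z => L ((tangentChart E q₀).symm z)) y.1 h.hasFDerivAt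
    (hasFDerivAt_prodMk_left y.1 y.2)).fderiv

lemma contDiffOn_lagrangian_tangentChart {L : TangentBundle 𝓘(ℝ, E) Q → ℝ}
    (hL : ContMDiff 𝓘(ℝ, E).tangent 𝓘(ℝ, ℝ) ∞ L) (q₀ : Q) :
    ContDiffOn ℝ ∞ (fun z => L ((tangentChart E q₀).symm z)) (tangentChart E q₀).target :=
  (hL.comp_contMDiffOn (contMDiffOn_extChartAt_symm _)).contDiffOn

/-- `Φ` is the expression of the flow of `Γ` in the natural chart of `TQ` at `q₀`, on times in
`(-δ, δ)` and initial conditions in the ball of radius `r` around the coordinates of the zero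
vector. -/
def RepresentsFlow (hc : IsCompleteField Γ) (q₀ : Q) (Φ : ℝ × (E × E) → E × E) (δ r : ℝ) : Prop :=
  ∀ t ∈ Ioo (-δ) δ, ∀ y ∈ Metric.ball (tangentChart E q₀ ⟨q₀, 0⟩) r,
    Φ (t, y) ∈ (tangentChart E q₀).target ∧
      sodeFlow hc t ((tangentChart E q₀).symm y) = (tangentChart E q₀).symm (Φ (t, y))

/-- Near a zero vector, a variational SODE is given in the natural chart by a small Lagrangian flow
which represents the global flow. -/
theorem exists_isSmallLagrangianFlow [FiniteDimensional ℝ E] [T2Space Q] (hΓ : IsSODE Γ)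
    (hc : IsCompleteField Γ) (hvar : IsVariationalSODE Γ) (q₀ : Q) :
    ∃ ℓ Φ S δ r r', IsSmallLagrangianFlow ℓ (fun y => (localField Γ q₀ y).2) Φ S
        (tangentChart E q₀ ⟨q₀, 0⟩) δ r r' ∧
      RepresentsFlow hc q₀ Φ δ r' := by
  have : CompleteSpace E := FiniteDimensional.complete ℝ E
  obtain ⟨L, hreg, hL⟩ := hvar
  set e := tangentChart E q₀ with he
  set y₀ := e ⟨q₀, 0⟩ with hy₀
  set ℓ : E × E → ℝ := fun z => L (e.symm z) with hℓ
  have hΩ : IsOpen e.target := isOpen_extChartAt_target _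
  have hℓs : ContDiffOn ℝ ∞ ℓ e.target := contDiffOn_lagrangian_tangentChart hreg.smooth q₀
  have hℓd : ∀ y ∈ e.target, DifferentiableAt ℝ ℓ y := fun y hy =>
    (hℓs.contDiffAt (hΩ.mem_nhds hy)).differentiableAt (by simp)
  have hy₀Ω : y₀ ∈ e.target := e.map_source (mem_extChartAt_source _)
  -- the field augmented by the Lagrangian, whose flow computes the action
  let X : (E × E) × ℝ → (E × E) × ℝ := fun z => (localField Γ q₀ z.1, ℓ z.1)
  have hX : ContDiffOn ℝ ∞ X (e.target ×ˢ univ) :=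
    ((hΓ.contDiffOn_localField q₀).comp contDiffOn_fst fun z hz => hz.1).prodMk
      (hℓs.comp contDiffOn_fst fun z hz => hz.1)
  obtain ⟨Ψ, δ, hδ, r, hr, hΨs, hΨ0, hΨ⟩ := exists_contDiffOn_localFlow (hΩ.prod isOpen_univ) hX
    (y₀ := (y₀, 0)) ⟨hy₀Ω, mem_univ _⟩
  have hball : ∀ y ∈ Metric.ball y₀ r, (y, (0 : ℝ)) ∈ Metric.ball (y₀, (0 : ℝ)) r := by
    intro y hy
    rw [← ball_prod_same]
    exact ⟨hy, Metric.mem_ball_self hr⟩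
  let Φ : ℝ × (E × E) → E × E := fun p => (Ψ (p.1, (p.2, 0))).1
  let S : ℝ × (E × E) → ℝ := fun p => (Ψ (p.1, (p.2, 0))).2
  have hin : ContDiff ℝ ∞ fun p : ℝ × (E × E) => (p.1, (p.2, (0 : ℝ))) :=
    contDiff_fst.prodMk (contDiff_snd.prodMk contDiff_const)
  have hΨin : ContDiffOn ℝ ∞ (fun p : ℝ × (E × E) => Ψ (p.1, (p.2, 0)))
      (Ioo (-δ) δ ×ˢ Metric.ball y₀ r) :=
    hΨs.comp hin.contDiffOn fun p hp => ⟨hp.1, hball _ hp.2⟩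
  have hΦΩ : ∀ t ∈ Ioo (-δ) δ, ∀ y ∈ Metric.ball y₀ r, Φ (t, y) ∈ e.target :=
    fun t ht y hy => (hΨ t ht _ (hball y hy)).1.1
  have hΦd : ∀ t ∈ Ioo (-δ) δ, ∀ y ∈ Metric.ball y₀ r,
      HasDerivAt (fun s => Φ (s, y)) (localField Γ q₀ (Φ (t, y))) t := fun t ht y hy =>
    (hΨ t ht _ (hball y hy)).2.fst
  have hcurve : ∀ t ∈ Ioo (-δ) δ, ∀ y ∈ Metric.ball y₀ r,
      HasMFDerivAt 𝓘(ℝ, ℝ) 𝓘(ℝ, E).tangent (fun s => e.symm (Φ (s, y))) t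
        ((1 : ℝ →L[ℝ] ℝ).smulRight (Γ (e.symm (Φ (t, y))))) := fun t ht y hy =>
    hasMFDerivAt_tangentChart_symm_comp (γ := fun s => Φ (s, y)) (hΦΩ t ht y hy) (hΦd t ht y hy)
  have hflow : IsLagrangianFlow ℓ (fun y => (localField Γ q₀ y).2) Φ S y₀ δ r :=
    { time_pos := hδ
      radius_pos := hr
      contDiffOn_flow := hΨin.fst
      contDiffOn_action := hΨin.snd
      flow_zero := fun y hy => congrArg Prod.fst (hΨ0 _ (hball y hy))
      action_zero := fun y hy => congrArg Prod.snd (hΨ0 _ (hball y hy))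
      hasDerivAt_flow := fun t ht y hy => (hΦd t ht y hy).congr_deriv
        (Prod.ext (hΓ.localField_fst (hΦΩ t ht y hy)) rfl)
      hasDerivAt_action := fun t ht y hy => (hΨ t ht _ (hball y hy)).2.snd
      contDiffAt_lagrangian := fun t ht y hy =>
        hℓs.contDiffAt (hΩ.mem_nhds (hΦΩ t ht y hy))
      euler_lagrange := by
        intro t ht y hy
        let c : ℝ → Q := fun s => (e.symm (Φ (s, y))).proj
        have hvel : ∀ s ∈ Ioo (-δ) δ, velocityLift (E := E) c s = e.symm (Φ (s, y)) :=
          fun s hs => hΓ.velocityLift_proj (γ := fun s => e.symm (Φ (s, y))) (hcurve s hs y hy)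
        have hcs : ContMDiffOn 𝓘(ℝ, ℝ) 𝓘(ℝ, E) 2 c (Ioo (-δ) δ) := by
          have h1 : ContDiffOn ℝ ∞ (fun s => Φ (s, y)) (Ioo (-δ) δ) :=
            hΨin.fst.comp (contDiffOn_id.prodMk contDiffOn_const) fun s hs => ⟨hs, hy⟩
          have h2 : ContMDiffOn 𝓘(ℝ, ℝ) 𝓘(ℝ, E).tangent ∞ (fun s => e.symm (Φ (s, y)))
              (Ioo (-δ) δ) :=
            (contMDiffOn_extChartAt_symm _).comp h1.contMDiffOn fun s hs => hΦΩ s hs y hy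
          exact ((Bundle.contMDiff_proj (TangentSpace 𝓘(ℝ, E) (M := Q))).comp_contMDiffOn
            h2).of_le (by norm_cast)
        have hsol : SolvesSODE Γ c (Ioo (-δ) δ) := by
          intro s hs
          have h1 := (hcurve s hs y hy).hasMFDerivWithinAt (s := Ioo (-δ) δ)
          rw [hvel s hs]
          exact h1.congr_of_eventuallyEq (eventually_mem_nhdsWithin.mono hvel) (hvel s hs)
        have hEL := (hL _ isOpen_Ioo ordConnected_Ioo c hcs).1 hsol t ht q₀
          (mem_tangentChart_source.1 (e.map_target (hΦΩ t ht y hy)))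
        have hpos : ∀ s ∈ Ioo (-δ) δ, extChartAt 𝓘(ℝ, E) q₀ (c s) = (Φ (s, y)).1 := fun s hs =>
          congrArg Prod.fst (e.right_inv (hΦΩ s hs y hy))
        have hder : ∀ s ∈ Ioo (-δ) δ,
            deriv (fun r => extChartAt 𝓘(ℝ, E) q₀ (c r)) s = (Φ (s, y)).2 := by
          intro s hs
          rw [← hΓ.localField_fst (hΦΩ s hs y hy)]
          refine HasDerivAt.deriv (HasDerivAt.congr_of_eventuallyEq (hΦd s hs y hy).fst ?_)
          filter_upwards [isOpen_Ioo.mem_nhds hs] with s' hs' using hpos s' hs'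
        rw [hpos t ht, hder t ht, dLdq_eq_positionPartial (hℓd _ (hΦΩ t ht y hy))] at hEL
        refine hEL.congr_of_eventuallyEq ?_
        filter_upwards [isOpen_Ioo.mem_nhds ht] with s hs
        rw [hpos s hs, hder s hs, dLdv_eq_velocityPartial (hℓd _ (hΦΩ s hs y hy))] }
  have hzero : ∀ y ∈ Metric.ball y₀ r, y ∈ e.target := fun y hy => by
    have := hΦΩ 0 hflow.zero_mem y hy
    rwa [hflow.flow_zero y hy] at this
  obtain ⟨δ', r₁, r₂, hδ', hr₂, hsmall⟩ := hflow.exists_small (fun y hy d hd => by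
    have hyΩ := hzero y hy
    have htgt : e.target = (extChartAt 𝓘(ℝ, E) q₀).target ×ˢ univ := tangentChart_target q₀
    have hy1 : y.1 ∈ (extChartAt 𝓘(ℝ, E) q₀).target := by rw [htgt] at hyΩ; exact hyΩ.1
    refine hreg.nondegenerate q₀ y.1 hy1 y.2 d fun f => ?_
    have h1 : (fun u => dLdv L q₀ y.1 u) = fun u => velocityPartial ℓ (y.1, u) := by
      funext u
      exact dLdv_eq_velocityPartial (y := (y.1, u)) (hℓd _ (by rw [htgt]; exact ⟨hy1, mem_univ _⟩))
    have hvp : HasFDerivAt (velocityPartial ℓ) (fderiv ℝ (velocityPartial ℓ) y) (y.1, y.2) :=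
      ((contDiffAt_velocityPartial (hℓs.contDiffAt (hΩ.mem_nhds hyΩ))).differentiableAt
        (by simp)).hasFDerivAt
    have h2 := hvp.comp y.2 (hasFDerivAt_prodMk_right y.1 y.2)
    rw [h1, show fderiv ℝ (fun u => velocityPartial ℓ (y.1, u)) y.2 = _ from h2.fderiv]
    exact hd f)
  refine ⟨ℓ, Φ, S, δ', r₁, r₂, hsmall, fun t ht y hy => ?_⟩
  have ht' : t ∈ Ioo (-δ) δ := ⟨by linarith [ht.1], by linarith [ht.2]⟩
  have hy' : y ∈ Metric.ball y₀ r := Metric.ball_subset_ball hr₂ hy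
  refine ⟨hΦΩ t ht' y hy', ?_⟩
  have h1 := sodeFlow_eqOn hΓ hc hδ (γ := fun s => e.symm (Φ (s, y)))
    (fun s hs => (hcurve s hs y hy').hasMFDerivWithinAt) ht'
  simpa only [hflow.flow_zero y hy'] using h1

end VariationalFlow

/-! ### Transfer to the manifold -/

section Assembly

variable {E : Type*} [NormedAddCommGroup E] [NormedSpace ℝ E]
  {Q : Type*} [TopologicalSpace Q] [ChartedSpace E Q] [IsManifold 𝓘(ℝ, E) ∞ Q]
  {Γ : (v : TangentBundle 𝓘(ℝ, E) Q) → TangentSpace 𝓘(ℝ, E).tangent v}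
  {hc : IsCompleteField Γ} {q₀ : Q} {ℓ : E × E → ℝ} {G : E × E → E} {Φ : ℝ × (E × E) → E × E}
  {S : ℝ × (E × E) → ℝ} {δ r r' h t : ℝ}

/-- The set of tangent vectors with coordinates in the ball of radius `r` around the coordinates of
the zero vector at `q₀`. -/
def chartBall (E : Type*) [NormedAddCommGroup E] [NormedSpace ℝ E]
    {Q : Type*} [TopologicalSpace Q] [ChartedSpace E Q] [IsManifold 𝓘(ℝ, E) ∞ Q] (q₀ : Q)
    (r : ℝ) : Set (TangentBundle 𝓘(ℝ, E) Q) :=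
  (tangentChart E q₀).source ∩ tangentChart E q₀ ⁻¹' Metric.ball (tangentChart E q₀ ⟨q₀, 0⟩) r

lemma chartBall_mem_nhds (q₀ : Q) (hr : 0 < r) :
    chartBall E q₀ r ∈ 𝓝 (⟨q₀, 0⟩ : TangentBundle 𝓘(ℝ, E) Q) :=
  Filter.inter_mem (extChartAt_source_mem_nhds _)
    ((continuousAt_extChartAt _).preimage_mem_nhds (Metric.ball_mem_nhds _ hr))

lemma tangentChart_zero_snd (q₀ : Q) :
    (tangentChart E q₀ (⟨q₀, 0⟩ : TangentBundle 𝓘(ℝ, E) Q)).2 = 0 := by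
  rw [tangentChart_snd (mem_chart_source E q₀)]
  exact map_zero _

namespace RepresentsFlow

lemma flow_mem_source (hΦ : RepresentsFlow hc q₀ Φ δ r') (ht : t ∈ Ioo (-δ) δ)
    {v : TangentBundle 𝓘(ℝ, E) Q} (hv : v ∈ chartBall E q₀ r') :
    sodeFlow hc t v ∈ (tangentChart E q₀).source ∧
      tangentChart E q₀ (sodeFlow hc t v) = Φ (t, tangentChart E q₀ v) := by
  obtain ⟨h1, h2⟩ := hΦ t ht _ hv.2
  rw [(tangentChart E q₀).left_inv hv.1] at h2
  rw [h2]
  exact ⟨(tangentChart E q₀).map_target h1, (tangentChart E q₀).right_inv h1⟩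

lemma flow_proj_mem_source (hΦ : RepresentsFlow hc q₀ Φ δ r') (ht : t ∈ Ioo (-δ) δ)
    {v : TangentBundle 𝓘(ℝ, E) Q} (hv : v ∈ chartBall E q₀ r') :
    (sodeFlow hc t v).proj ∈ (extChartAt 𝓘(ℝ, E) q₀).source := by
  rw [extChartAt_source]
  exact mem_tangentChart_source.1 (hΦ.flow_mem_source ht hv).1

lemma extChartAt_flow_proj (hΦ : RepresentsFlow hc q₀ Φ δ r') (ht : t ∈ Ioo (-δ) δ)
    {v : TangentBundle 𝓘(ℝ, E) Q} (hv : v ∈ chartBall E q₀ r') :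
    extChartAt 𝓘(ℝ, E) q₀ (sodeFlow hc t v).proj = (Φ (t, tangentChart E q₀ v)).1 :=
  congrArg Prod.fst (hΦ.flow_mem_source ht hv).2

lemma flow_two_mul [CompleteSpace E] [T2Space Q] (hΓ : IsSODE Γ)
    (H : IsSmallLagrangianFlow ℓ G Φ S (tangentChart E q₀ ⟨q₀, 0⟩) δ r r')
    (hΦ : RepresentsFlow hc q₀ Φ δ r') (h0 : 0 < h) (hδ : 2 * h < δ)
    {v : TangentBundle 𝓘(ℝ, E) Q} (hv : v ∈ chartBall E q₀ r) :
    Φ (2 * h, tangentChart E q₀ v) = Φ (h, Φ (h, tangentChart E q₀ v)) := by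
  have ht : h ∈ Ioo (-δ) δ := ⟨by linarith, by linarith⟩
  have ht2 : 2 * h ∈ Ioo (-δ) δ := ⟨by linarith, hδ⟩
  have hv' : v ∈ chartBall E q₀ r' := ⟨hv.1, H.ball_subset hv.2⟩
  obtain ⟨h1, h2⟩ := hΦ.flow_mem_source ht hv'
  have hw : sodeFlow hc h v ∈ chartBall E q₀ r' := by
    refine ⟨h1, ?_⟩
    rw [mem_preimage, h2]
    exact H.mapsTo_flow h ht _ hv.2
  rw [← (hΦ.flow_mem_source ht2 hv').2, two_mul, sodeFlow_add hΓ, (hΦ.flow_mem_source ht hw).2, h2]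

end RepresentsFlow

/-- For small `h` the exponential map is a diffeomorphism onto the square of a chart ball of radius
proportional to `h`, which the discrete dynamics of the constant pair does not leave. -/
theorem exists_isExpInverse [FiniteDimensional ℝ E]
    (H : IsSmallLagrangianFlow ℓ G Φ S (tangentChart E q₀ ⟨q₀, 0⟩) δ r r')
    (hΦ : RepresentsFlow hc q₀ Φ δ r') (h0 : 0 < h) (hδ : 2 * h < δ) (h1 : h ≤ 1) :
    ∃ (U : Set Q) (D : Set (TangentBundle 𝓘(ℝ, E) Q)) (R : Q × Q → TangentBundle 𝓘(ℝ, E) Q),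
      IsExpInverse hc h U D R ∧ D ⊆ chartBall E q₀ r ∧ q₀ ∈ U ∧
        discreteOfSODE hc h R (q₀, q₀) ∈ (U ×ˢ U) ×ˢ (U ×ˢ U) := by
  set e := tangentChart E q₀ with he
  set y₀ := e ⟨q₀, 0⟩ with hy₀
  set φ := extChartAt 𝓘(ℝ, E) q₀ with hφ
  have hr := H.inner_pos
  have hδ' : h < δ := by linarith
  have ht : h ∈ Ioo (-δ) δ := ⟨by linarith, hδ'⟩
  have ht2 : 2 * h ∈ Ioo (-δ) δ := ⟨by linarith, hδ⟩
  have hy2 : y₀.2 = 0 := tangentChart_zero_snd q₀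
  set O := Metric.ball y₀.1 (h * (r / 16))
  have hOpos : 0 < h * (r / 16) := by positivity
  have hOo : IsOpen O := Metric.isOpen_ball
  have hball : Metric.ball y₀ r' ⊆ e.target := fun y hy => by
    have := (hΦ 0 H.zero_mem y hy).1
    rwa [H.flow_zero y hy] at this
  choose! ρ hρ hρexp using fun p (hp : p ∈ O ×ˢ O) =>
    H.exists_localExp_eq hy2 h0 hδ' h1 hp.1 hp.2
  have hρ' : MapsTo ρ (O ×ˢ O) (Metric.ball y₀ r') := fun p hp => H.ball_subset (hρ p hp)
  have hρsm : ContDiffOn ℝ ∞ ρ (O ×ˢ O) :=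
    H.contDiffOn_of_localExp_rightInverse h0 hδ' (hOo.prod hOo) hρ' hρexp
  let B : Set (E × E) := Metric.ball y₀ r ∩ localExp Φ h ⁻¹' (O ×ˢ O)
  have hB : IsOpen B := by
    refine ContinuousOn.isOpen_inter_preimage (fun y hy => ?_) Metric.isOpen_ball (hOo.prod hOo)
    exact (H.contDiffAt_localExp h0 hδ' (H.ball_subset hy)).continuousAt.continuousWithinAt
  let U : Set Q := φ.source ∩ φ ⁻¹' O
  let D : Set (TangentBundle 𝓘(ℝ, E) Q) := e.source ∩ e ⁻¹' B
  let R : Q × Q → TangentBundle 𝓘(ℝ, E) Q := fun p => e.symm (ρ (φ p.1, φ p.2))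
  have hDball : D ⊆ chartBall E q₀ r := fun v hv => ⟨hv.1, hv.2.1⟩
  have hDball' : D ⊆ chartBall E q₀ r' := fun v hv => ⟨hv.1, H.ball_subset hv.2.1⟩
  have hchart : ∀ p ∈ U ×ˢ U, (φ p.1, φ p.2) ∈ O ×ˢ O := fun p hp => ⟨hp.1.2, hp.2.2⟩
  have hRsrc : ∀ p ∈ U ×ˢ U, R p ∈ e.source ∧ e (R p) = ρ (φ p.1, φ p.2) := fun p hp =>
    ⟨e.map_target (hball (hρ' (hchart p hp))), e.right_inv (hball (hρ' (hchart p hp)))⟩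
  have hsrc : ∀ v ∈ e.source, v.proj ∈ φ.source := fun v hv => by
    rw [hφ, extChartAt_source]
    exact mem_tangentChart_source.1 hv
  -- the exponential map in coordinates
  have hexp1 : ∀ v ∈ D, (sodeExp hc h v).1 ∈ φ.source ∧ (sodeExp hc h v).2 ∈ φ.source :=
    fun v hv => ⟨hsrc v hv.1, hΦ.flow_proj_mem_source ht (hDball' hv)⟩
  have hexp2 : ∀ v ∈ D, (φ (sodeExp hc h v).1, φ (sodeExp hc h v).2) = localExp Φ h (e v) :=
    fun v hv => Prod.ext rfl (hΦ.extChartAt_flow_proj ht (hDball' hv))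
  have hmaps : MapsTo (sodeExp hc h) D (U ×ˢ U) := fun v hv => by
    have h2 := hv.2.2
    rw [mem_preimage, ← hexp2 v hv] at h2
    exact ⟨⟨(hexp1 v hv).1, h2.1⟩, ⟨(hexp1 v hv).2, h2.2⟩⟩
  have hmapsR : MapsTo R (U ×ˢ U) D := fun p hp => by
    refine ⟨(hRsrc p hp).1, ?_⟩
    rw [mem_preimage, (hRsrc p hp).2]
    refine ⟨hρ _ (hchart p hp), ?_⟩
    rw [mem_preimage, hρexp _ (hchart p hp)]
    exact hchart p hp
  have hq₀ : q₀ ∈ U := ⟨mem_extChartAt_source q₀, Metric.mem_ball_self hOpos⟩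
  have hproj : ContMDiff 𝓘(ℝ, E).tangent 𝓘(ℝ, E) ∞
      (fun v : TangentBundle 𝓘(ℝ, E) Q => v.proj) :=
    Bundle.contMDiff_proj (TangentSpace 𝓘(ℝ, E) (M := Q))
  refine ⟨U, D, R,
    ⟨(continuousOn_extChartAt _).isOpen_inter_preimage (isOpen_extChartAt_source _) hOo,
    (continuousOn_extChartAt _).isOpen_inter_preimage (isOpen_extChartAt_source _) hB,
    hmaps, hmapsR, ⟨fun v hv => ?_, fun p hp => ?_⟩, ?_, ?_⟩, hDball, hq₀, ?_⟩
  · change e.symm (ρ (φ (sodeExp hc h v).1, φ (sodeExp hc h v).2)) = v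
    have h2 : ρ (localExp Φ h (e v)) = e v :=
      H.localExp_injOn h0 hδ' (hρ' hv.2.2) (H.ball_subset hv.2.1) (hρexp _ hv.2.2)
    rw [hexp2 v hv, h2, e.left_inv hv.1]
  · have h2 := hexp2 (R p) (hmapsR hp)
    rw [(hRsrc p hp).2, hρexp _ (hchart p hp)] at h2
    have h3 := hexp1 (R p) (hmapsR hp)
    exact Prod.ext (φ.injOn h3.1 hp.1.1 (congrArg Prod.fst h2))
      (φ.injOn h3.2 hp.2.1 (congrArg Prod.snd h2))
  · refine hproj.contMDiffOn.prodMk ?_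
    have h2 : ContDiffOn ℝ ∞ (fun y => (localExp Φ h y).2) B := fun y hy =>
      (H.contDiffAt_localExp h0 hδ' (H.ball_subset hy.1)).snd.contDiffWithinAt
    have h3 : ContMDiffOn 𝓘(ℝ, E).tangent 𝓘(ℝ, E × E) ∞ e D :=
      (contMDiffOn_extChartAt (x := (⟨q₀, 0⟩ : TangentBundle 𝓘(ℝ, E) Q))).mono fun v hv => by
        have := hv.1
        rwa [he, tangentChart, extChartAt_source] at this
    have h4 : ContMDiffOn 𝓘(ℝ, E).tangent 𝓘(ℝ, E) ∞ (fun v => φ.symm (localExp Φ h (e v)).2) D := by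
      refine (contMDiffOn_extChartAt_symm q₀).comp (h2.contMDiffOn.comp h3 fun v hv => hv.2)
        fun v hv => ?_
      have h5 := φ.map_source (hexp1 v hv).2
      have h6 : φ (sodeExp hc h v).2 = (localExp Φ h (e v)).2 := congrArg Prod.snd (hexp2 v hv)
      rwa [h6] at h5
    refine h4.congr fun v hv => ?_
    have h6 : φ (sodeExp hc h v).2 = (localExp Φ h (e v)).2 := congrArg Prod.snd (hexp2 v hv)
    change (sodeExp hc h v).2 = φ.symm (localExp Φ h (e v)).2
    rw [← h6, φ.left_inv (hexp1 v hv).2]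
  · have hφsm : ContMDiffOn 𝓘(ℝ, E) 𝓘(ℝ, E) ∞ φ U :=
      contMDiffOn_extChartAt.mono fun x hx => by
        have := hx.1
        rwa [hφ, extChartAt_source] at this
    have h2 : ContMDiffOn (𝓘(ℝ, E).prod 𝓘(ℝ, E)) 𝓘(ℝ, E × E) ∞
        (fun p : Q × Q => (φ p.1, φ p.2)) (U ×ˢ U) :=
      (hφsm.comp contMDiffOn_fst fun p hp => hp.1).prodMk_space
        (hφsm.comp contMDiffOn_snd fun p hp => hp.2)
    exact (contMDiffOn_extChartAt_symm _).comp (hρsm.contMDiffOn.comp h2 hchart)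
      fun p hp => hball (hρ' (hchart p hp))
  · have hqq : (q₀, q₀) ∈ U ×ˢ U := ⟨hq₀, hq₀⟩
    have hRD := hmapsR hqq
    refine ⟨hqq, hq₀, hΦ.flow_proj_mem_source ht2 (hDball' hRD), ?_⟩
    change φ (sodeFlow hc (2 * h) (R (q₀, q₀))).proj ∈ O
    rw [hΦ.extChartAt_flow_proj ht2 (hDball' hRD)]
    refine H.flow_two_mul_mem_ball hy2 h0 hδ (hDball' hRD).2 ?_
    rw [(hRsrc _ hqq).2, hρexp _ (hchart _ hqq)]
    rfl

/-- The exact discrete Lagrangian makes the discrete equation variational, whatever square the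
exponential map is a diffeomorphism onto. -/
theorem isVariationalSOdE_of_isExpInverse [FiniteDimensional ℝ E] [T2Space Q] (hΓ : IsSODE Γ)
    (H : IsSmallLagrangianFlow ℓ G Φ S (tangentChart E q₀ ⟨q₀, 0⟩) δ r r')
    (hΦ : RepresentsFlow hc q₀ Φ δ r') (h0 : 0 < h) (hδ : 2 * h < δ)
    {U : Set Q} {D : Set (TangentBundle 𝓘(ℝ, E) Q)} {R : Q × Q → TangentBundle 𝓘(ℝ, E) Q}
    (hR : IsExpInverse hc h U D R) (hD : D ⊆ chartBall E q₀ r) :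
    IsVariationalSOdE E (U ×ˢ U) (discreteOfSODE hc h R) := by
  have : CompleteSpace E := FiniteDimensional.complete ℝ E
  set e := tangentChart E q₀ with he
  set y₀ := e ⟨q₀, 0⟩ with hy₀
  set φ := extChartAt 𝓘(ℝ, E) q₀ with hφ
  have hδ' : h < δ := by linarith
  have ht : h ∈ Ioo (-δ) δ := ⟨by linarith, hδ'⟩
  have ht2 : 2 * h ∈ Ioo (-δ) δ := ⟨by linarith, hδ⟩
  have hRr : ∀ p ∈ U ×ˢ U, R p ∈ chartBall E q₀ r := fun p hp => hD (hR.mapsTo_inv hp)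
  have hRr' : ∀ p ∈ U ×ˢ U, R p ∈ chartBall E q₀ r' := fun p hp =>
    ⟨(hRr p hp).1, H.ball_subset (hRr p hp).2⟩
  have hR1 : ∀ p ∈ U ×ˢ U, (R p).proj = p.1 := fun p hp => congrArg Prod.fst (hR.invOn.2 hp)
  have hR2 : ∀ p ∈ U ×ˢ U, (sodeFlow hc h (R p)).proj = p.2 := fun p hp =>
    congrArg Prod.snd (hR.invOn.2 hp)
  have hUsrc : ∀ a ∈ U, a ∈ (chartAt E q₀).source := fun a ha => by
    have h1 := mem_tangentChart_source.1 (hRr (a, a) ⟨ha, ha⟩).1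
    rwa [hR1 (a, a) ⟨ha, ha⟩] at h1
  have hUsrc' : ∀ a ∈ U, a ∈ φ.source := fun a ha => by
    rw [hφ, extChartAt_source]
    exact hUsrc a ha
  -- the inverse of the exponential map in coordinates
  let O : Set E := φ.target ∩ φ.symm ⁻¹' U
  have hO : IsOpen O :=
    (continuousOn_extChartAt_symm _).isOpen_inter_preimage (isOpen_extChartAt_target _)
      hR.isOpen_base
  have hφO : ∀ a ∈ U, φ a ∈ O := fun a ha => by
    refine ⟨φ.map_source (hUsrc' a ha), ?_⟩
    rw [mem_preimage, φ.left_inv (hUsrc' a ha)]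
    exact ha
  let ρ : E × E → E × E := fun p => e (R (φ.symm p.1, φ.symm p.2))
  have hρφ : ∀ a ∈ U, ∀ b ∈ U, ρ (φ a, φ b) = e (R (a, b)) := fun a ha b hb => by
    simp only [ρ, φ.left_inv (hUsrc' a ha), φ.left_inv (hUsrc' b hb)]
  have hρ : MapsTo ρ (O ×ˢ O) (Metric.ball y₀ r) := fun p hp =>
    (hRr (φ.symm p.1, φ.symm p.2) ⟨hp.1.2, hp.2.2⟩).2
  have hinv : ∀ p ∈ O ×ˢ O, localExp Φ h (ρ p) = p := fun p hp => by
    have hp' : (φ.symm p.1, φ.symm p.2) ∈ U ×ˢ U := ⟨hp.1.2, hp.2.2⟩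
    refine Prod.ext ?_ ?_
    · change φ (R (φ.symm p.1, φ.symm p.2)).proj = p.1
      rw [hR1 _ hp', φ.right_inv hp.1.1]
    · change (Φ (h, e (R (φ.symm p.1, φ.symm p.2)))).1 = p.2
      rw [← hΦ.extChartAt_flow_proj ht (hRr' _ hp'), hR2 _ hp', ← hφ, φ.right_inv hp.2.1]
  let Ld : Q × Q → ℝ := fun p => S (h, e (R p))
  have hLd : ∀ a ∈ U, ∀ b ∈ U, Ld (a, b) = S (h, ρ (φ a, φ b)) := fun a ha b hb => by
    rw [hρφ a ha b hb]
  let A : ∀ a : Q, TangentSpace 𝓘(ℝ, E) a →L[ℝ] E := fun a => mfderiv 𝓘(ℝ, E) 𝓘(ℝ, E) φ a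
  have hA : ∀ a ∈ U, HasMFDerivAt 𝓘(ℝ, E) 𝓘(ℝ, E) φ a (A a) := fun a ha =>
    (mdifferentiableAt_extChartAt (hUsrc a ha)).hasMFDerivAt
  have hAbij : ∀ a ∈ U, Function.Bijective (A a) := fun a ha =>
    (isInvertible_mfderiv_extChartAt (hUsrc' a ha)).bijective
  -- the slot derivatives in coordinates
  have hone : ∀ a ∈ U, ∀ b ∈ U, slotDerivOne (E := E) Ld a b =
      (-velocityPartial ℓ (ρ (φ a, φ b))).comp (A a) := fun a ha b hb => by
    have h1 := (H.hasFDerivAt_discreteLagrangian_left h0 hδ' hO hρ hinv (hφO a ha)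
      (hφO b hb)).hasMFDerivAt.comp a (hA a ha)
    refine (h1.congr_of_eventuallyEq ?_).mfderiv
    filter_upwards [hR.isOpen_base.mem_nhds ha] with x hx using hLd x hx b hb
  have htwo : ∀ a ∈ U, ∀ b ∈ U, slotDerivTwo (E := E) Ld a b =
      (velocityPartial ℓ (Φ (h, ρ (φ a, φ b)))).comp (A b) := fun a ha b hb => by
    have h1 := (H.hasFDerivAt_discreteLagrangian_right h0 hδ' hO hρ hinv (hφO a ha)
      (hφO b hb)).hasMFDerivAt.comp b (hA b hb)
    refine (h1.congr_of_eventuallyEq ?_).mfderiv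
    filter_upwards [hR.isOpen_base.mem_nhds hb] with x hx using hLd a ha x hx
  refine ⟨Ld, ⟨?_, ?_⟩, ?_⟩
  · have h1 : ContDiffOn ℝ ∞ (fun y => S (h, y)) (Metric.ball y₀ r') :=
      H.contDiffOn_action.comp (contDiffOn_const.prodMk contDiffOn_id) fun y hy => ⟨ht, hy⟩
    have h2 : ContMDiffOn 𝓘(ℝ, E).tangent 𝓘(ℝ, E × E) ∞ e e.source := by
      rw [he, tangentChart, extChartAt_source]
      exact contMDiffOn_extChartAt
    exact h1.contMDiffOn.comp (h2.comp hR.smooth_inv fun p hp => (hRr p hp).1)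
      fun p hp => (hRr' p hp).2
  · rintro a b ⟨ha, hb⟩ w hw
    have hdiff : DifferentiableAt ℝ (fun x => -velocityPartial ℓ (ρ (φ a, x)) (A a w)) (φ b) := by
      have h1 := H.differentiableAt_momentum h0 hδ' hO hρ hinv (p := (φ a, φ b))
        ⟨hφO a ha, hφO b hb⟩
      have h2 : DifferentiableAt ℝ (fun x => velocityPartial ℓ (ρ (φ a, x))) (φ b) :=
        DifferentiableAt.comp (g := fun q => velocityPartial ℓ (ρ q)) (φ b) h1
          (hasFDerivAt_prodMk_right (φ a) (φ b)).differentiableAt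
      exact (h2.clm_apply (differentiableAt_const _)).neg
    have hmix : mixedDeriv (E := E) Ld a b w =
        (fderiv ℝ (fun x => -velocityPartial ℓ (ρ (φ a, x)) (A a w)) (φ b)).comp (A b) := by
      have h1 := hdiff.hasFDerivAt.hasMFDerivAt.comp b (hA b hb)
      refine (h1.congr_of_eventuallyEq ?_).mfderiv
      filter_upwards [hR.isOpen_base.mem_nhds hb] with x hx
      rw [hone a ha x hx]
      rfl
    have hzero : A a w = 0 := by
      refine H.discreteLagrangian_nondegenerate h0 hδ' hO hρ hinv (hφO a ha) (hφO b hb)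
        fun u => ?_
      obtain ⟨u', rfl⟩ := (hAbij b hb).2 u
      have h1 := hw u'
      rw [hmix] at h1
      exact h1
    exact (hAbij a ha).1 (hzero.trans (map_zero (A a)).symm)
  · rintro a b c ⟨ha, hb⟩ ⟨-, hc'⟩
    have hab : (a, b) ∈ U ×ˢ U := ⟨ha, hb⟩
    have hstep : discreteOfSODE hc h R (a, b) = ((a, b), (b, c)) ↔
        (Φ (2 * h, ρ (φ a, φ b))).1 = φ c := by
      rw [hρφ a ha b hb, ← hΦ.extChartAt_flow_proj ht2 (hRr' _ hab)]
      constructor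
      · intro heq
        exact congrArg φ (congrArg (fun z => z.2.2) heq :)
      · intro heq
        have h1 := φ.injOn (hΦ.flow_proj_mem_source ht2 (hRr' _ hab)) (hUsrc' c hc') heq
        simp only [discreteOfSODE, h1]
    rw [hstep, H.discrete_eulerLagrange_iff h0 hδ' hρ hinv (hφO a ha) (hφO b hb) (hφO c hc')
      (by rw [hρφ a ha b hb]; exact hΦ.flow_two_mul hΓ H h0 hδ (hRr _ hab)),
      hone b hb c hc', htwo a ha b hb]
    constructor
    · intro heq
      refine ContinuousLinearMap.ext fun u => ?_
      exact congrArg (fun B : E →L[ℝ] ℝ => B (A b u)) heq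
    · intro heq
      refine ContinuousLinearMap.ext fun u => ?_
      obtain ⟨u', rfl⟩ := (hAbij b hb).2 u
      exact congrArg (fun B : TangentSpace 𝓘(ℝ, E) b →L[ℝ] ℝ => B u') heq

end Assembly

theorem mainTheorem4
    {E : Type*} [NormedAddCommGroup E] [NormedSpace ℝ E] [FiniteDimensional ℝ E]
    {Q : Type*} [TopologicalSpace Q] [ChartedSpace E Q] [IsManifold 𝓘(ℝ, E) ∞ Q]
    [T2Space Q] [SecondCountableTopology Q]
    (Γ : (v : TangentBundle 𝓘(ℝ, E) Q) → TangentSpace 𝓘(ℝ, E).tangent v)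
    (hΓ : IsSODE Γ) (hc : IsCompleteField Γ) (hvar : IsVariationalSODE Γ) (q₀ : Q) :
    ∃ W ∈ 𝓝 (⟨q₀, 0⟩ : TangentBundle 𝓘(ℝ, E) Q), ∃ h₀ : ℝ, 0 < h₀ ∧
      ∀ h : ℝ, 0 < h → h < h₀ →
        (∃ (U : Set Q) (D : Set (TangentBundle 𝓘(ℝ, E) Q))
            (R : Q × Q → TangentBundle 𝓘(ℝ, E) Q),
          IsExpInverse hc h U D R ∧ D ⊆ W ∧ q₀ ∈ U ∧
            discreteOfSODE hc h R (q₀, q₀) ∈ (U ×ˢ U) ×ˢ (U ×ˢ U)) ∧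
        ∀ (U : Set Q) (D : Set (TangentBundle 𝓘(ℝ, E) Q))
            (R : Q × Q → TangentBundle 𝓘(ℝ, E) Q),
          IsExpInverse hc h U D R → D ⊆ W →
            IsVariationalSOdE E (U ×ˢ U) (discreteOfSODE hc h R) := by
  obtain ⟨ℓ, Φ, S, δ, r, r', H, hΦ⟩ := exists_isSmallLagrangianFlow hΓ hc hvar q₀
  -- `2 h < δ` since the discrete equation uses the flow at time `2 h`; `h ≤ 1` keeps the balls of
  -- radius proportional to `h` inside the ball of radius `r`
  refine ⟨chartBall E q₀ r, chartBall_mem_nhds q₀ H.inner_pos, min (δ / 2) 1,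
    lt_min (half_pos H.time_pos) one_pos, fun h h0 hh => ?_⟩
  have hδ : 2 * h < δ := by linarith [hh.trans_le (min_le_left _ _)]
  exact ⟨exists_isExpInverse H hΦ h0 hδ (hh.trans_le (min_le_right _ _)).le,
    fun U D R hR hD => isVariationalSOdE_of_isExpInverse hΓ H hΦ h0 hδ hR hD⟩
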